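/- **Theorem.** Let $f\colon Y\to X$ be a proper birational morphism of Noetherian normal schemes (*birational*: there is a dense open $U'\subseteq X$ with $f^{-1}(U')$ dense in $Y$ and $f^{-1}(U')\to U'$ an isomorphism). Let $U\subseteq X$ be the largest open subset over which $f$ is an isomorphism, and let $E$ be the reduced full exceptional divisor of $f$, i.e. the union, with its reduced structure, of all prime divisors of $Y$ contained in $Y\setminus f^{-1}(U)$. Assume that $E$ is Cartier, i.e. its ideal sheaf $\mathcal O_Y(-E)$ is locally generated by one nonzerodivisor. For a sheaf of modules $\mathcal F$ put $\mathcal F^{[m]}=(\mathcal F^{\otimes m})^{\vee\vee}$ and $\mathcal F(aE)=\mathcal F\otimes\mathcal O_Y(aE)=\mathcal Hom(\mathcal O_Y(-aE),\mathcal F)$. Let $m\ge 1$ be an integer. 1. Let $\omega_X$ and $\omega_Y$ be dualizing sheaves on $X$ and $Y$, i.e. quasi-coherent sheaves whose module of sections over each integral affine open $\operatorname{Spec}A$ is isomorphic to the lowest nonzero cohomology module of a dualizing complex of $A$. Suppose that they are normalized compatibly, in the sense that $(f_*\omega_Y)|_U\cong\omega_X|_U$ (as holds when $\omega_X$, $\omega_Y$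 are the lowest cohomology sheaves of $\omega_X^\bullet$ and $\omega_Y^\bullet=f^!\omega_X^\bullet$, for $X$ connected). Then there is an integer $a_0$ such that for all $a\ge a_0$ $$f_*\,\omega_Y^{[m]}(aE)\;\cong\;\omega_X^{[m]}.$$ 2. Let $X$ be moreover of finite type and of pure dimension $n$ over a perfect field $k$ of arbitrary characteristic, and let $\omega_X=(\bigwedge^n\Omega_{X/k})^{\vee\vee}$ and $\omega_Y=(\bigwedge^n\Omega_{Y/k})^{\vee\vee}$ be the canonical sheaves. Then there is an integer $a_0$ such that for all $a\ge a_0$ $$f_*\,\omega_Y^{[m]}(aE)\;\cong\;\omega_X^{[m]}.$$ -/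

import Mathlib

open CategoryTheory Opposite TopologicalSpace AlgebraicGeometry

universe u

namespace DirectImages

noncomputable section

variable {X Y : Scheme.{u}}

/-! ### Sheaf Hom, duals, reflexive powers -/

/-- Presheaves of `𝒪_X`-modules. -/
abbrev PreMod (X : Scheme.{u}) :=
  PresheafOfModules.{u} (X.presheaf ⋙ forget₂ CommRingCat RingCat)

/-- `Hom(P|_U, F|_U)`: families of `𝒪_X(V)`-linear maps `P(V) → F(V)`, for `V ⊆ U` open,
compatible with restriction. -/
def homSections (P : PreMod X) (F : X.Modules) (U : X.Opens) :
    AddSubgroup (∀ V : Set.Iic U, (P.obj (op V.1) →ₗ[Γ(X, V.1)] Γ(F, V.1))) where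
  carrier := {φ | ∀ (V W : Set.Iic U) (hWV : W.1 ≤ V.1) (p : P.obj (op V.1)),
    φ W (P.restrictₛₗ (homOfLE hWV).op p) = F.presheaf.map (homOfLE hWV).op (φ V p)}
  add_mem' {φ ψ} hφ hψ V W hWV p := by
    simp [hφ V W hWV p, hψ V W hWV p]
  zero_mem' V W hWV p := by simp
  neg_mem' {φ} hφ V W hWV p := by simp [hφ V W hWV p]

/-- The component over `V ≤ U` of a homomorphism `P|_U ⟶ F|_U`. -/
def homApp {P : PreMod X} {F : X.Modules} {U : X.Opens} (φ : homSections P F U) {V : X.Opens}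
    (hV : V ≤ U) : P.obj (op V) →ₗ[Γ(X, V)] Γ(F, V) := φ.1 ⟨V, hV⟩

lemma homSections_ext {P : PreMod X} {F : X.Modules} {U : X.Opens} {φ ψ : homSections P F U}
    (h : ∀ (V : X.Opens) (hV : V ≤ U) (p : P.obj (op V)), homApp φ hV p = homApp ψ hV p) :
    φ = ψ :=
  Subtype.ext (funext fun V ↦ LinearMap.ext fun p ↦ h V.1 V.2 p)

lemma homApp_res {P : PreMod X} {F : X.Modules} {U : X.Opens} (φ : homSections P F U)
    {V W : X.Opens} (hV : V ≤ U) (hWV : W ≤ V) (p : P.obj (op V)) :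
    homApp φ (hWV.trans hV) (P.restrictₛₗ (homOfLE hWV).op p) =
      F.presheaf.map (homOfLE hWV).op (homApp φ hV p) :=
  φ.2 ⟨V, hV⟩ ⟨W, hWV.trans hV⟩ hWV p

instance (P : PreMod X) (F : X.Modules) (U : X.Opens) : SMul Γ(X, U) (homSections P F U) where
  smul r φ := ⟨fun V ↦ X.presheaf.map (homOfLE V.2).op r • φ.1 V, fun V W hWV p ↦ by
    have h : X.presheaf.map (homOfLE W.2).op r =
        X.presheaf.map (homOfLE hWV).op (X.presheaf.map (homOfLE V.2).op r) := by
      rw [← ConcreteCategory.comp_apply, ← Functor.map_comp]; rfl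
    simp [φ.2 V W hWV p, h]⟩

lemma smul_val (P : PreMod X) (F : X.Modules) (U : X.Opens) (r : Γ(X, U)) (φ : homSections P F U)
    (V : Set.Iic U) :
    (r • φ).1 V = X.presheaf.map (homOfLE V.2).op r • φ.1 V := rfl

instance (P : PreMod X) (F : X.Modules) (U : X.Opens) : Module Γ(X, U) (homSections P F U) where
  one_smul φ := by ext V p; simp [smul_val]
  mul_smul r s φ := by ext V p; simp [smul_val, mul_smul]
  smul_zero r := by ext V p; simp [smul_val]
  smul_add r φ ψ := by ext V p; simp [smul_val]
  add_smul r s φ := by ext V p; simp [smul_val, add_smul]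
  zero_smul φ := by ext V p; simp [smul_val]

/-- Restriction `Hom(P|_U, F|_U) → Hom(P|_V, F|_V)` for `V ⊆ U`. -/
def homRestrict (P : PreMod X) (F : X.Modules) {U V : X.Opens} (h : V ≤ U) :
    homSections P F U →+ homSections P F V where
  toFun φ := ⟨fun W ↦ φ.1 ⟨W.1, W.2.trans h⟩,
    fun W W' hW p ↦ φ.2 ⟨W.1, W.2.trans h⟩ ⟨W'.1, W'.2.trans h⟩ hW p⟩
  map_zero' := rfl
  map_add' _ _ := rfl

/-- The presheaf of abelian groups `U ↦ Hom(P|_U, F|_U)`. -/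
def homPresheaf (P : PreMod X) (F : X.Modules) : TopCat.Presheaf Ab X where
  obj U := AddCommGrpCat.of (homSections P F U.unop)
  map {U V} i := AddCommGrpCat.ofHom (homRestrict P F i.unop.le)

instance (P : PreMod X) (F : X.Modules) (U : X.Opensᵒᵖ) :
    Module (X.ringCatSheaf.obj.obj U) ((homPresheaf P F).obj U) :=
  inferInstanceAs (Module Γ(X, U.unop) (homSections P F U.unop))

lemma homRestrict_smul (P : PreMod X) (F : X.Modules) {U V : X.Opens} (h : V ≤ U) (r : Γ(X, U))
    (φ : homSections P F U) :
    homRestrict P F h (r • φ) = X.presheaf.map (homOfLE h).op r • homRestrict P F h φ := by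
  apply Subtype.ext
  funext W
  change X.presheaf.map (homOfLE (W.2.trans h)).op r • φ.1 ⟨W.1, W.2.trans h⟩ =
    X.presheaf.map (homOfLE W.2).op (X.presheaf.map (homOfLE h).op r) • φ.1 ⟨W.1, W.2.trans h⟩
  rw [← ConcreteCategory.comp_apply, ← Functor.map_comp]; rfl

lemma map_map_apply (F : X.Modules) {U V W : X.Opens} (h : V ≤ U) (h' : W ≤ V) (s : Γ(F, U)) :
    F.presheaf.map (homOfLE h').op (F.presheaf.map (homOfLE h).op s) =
      F.presheaf.map (homOfLE (h'.trans h)).op s := by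
  rw [← ConcreteCategory.comp_apply, ← Functor.map_comp]; rfl

lemma preMod_map_map_apply (P : PreMod X) {U V W : X.Opens} (h : V ≤ U) (h' : W ≤ V)
    (s : P.obj (op U)) :
    P.restrictₛₗ (homOfLE h').op (P.restrictₛₗ (homOfLE h).op s) =
      P.restrictₛₗ (homOfLE (h'.trans h)).op s := 
  (PresheafOfModules.map_comp_apply P (homOfLE h).op (homOfLE h').op s).symm

theorem homPresheaf_isSheaf (P : PreMod X) (F : X.Modules) : (homPresheaf P F).IsSheaf := by
  rw [TopCat.Presheaf.isSheaf_iff_isSheafUniqueGluing]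
  intro ι U sf hsf
  change ∀ i, homSections P F (U i) at sf
  have hcomp : ∀ (i j : ι) (V : X.Opens) (hi : V ≤ U i) (hj : V ≤ U j) (p : P.obj (op V)),
      homApp (sf i) hi p = homApp (sf j) hj p := fun i j V hi hj p ↦
    congrArg (fun φ : homSections P F (U i ⊓ U j) ↦ homApp φ (le_inf hi hj) p) (hsf i j)
  have key : ∀ (V : Set.Iic (iSup U)) (p : P.obj (op V.1)), ∃! s : Γ(F, V.1), ∀ i,
      F.presheaf.map (homOfLE (inf_le_left : V.1 ⊓ U i ≤ V.1)).op s =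
        homApp (sf i) (inf_le_right : V.1 ⊓ U i ≤ U i)
          (P.restrictₛₗ (homOfLE inf_le_left).op p) := by
    intro V p
    refine TopCat.Sheaf.existsUnique_gluing' ⟨F.presheaf, F.isSheaf⟩ (fun i ↦ V.1 ⊓ U i) V.1
      (fun i ↦ homOfLE inf_le_left) ?_ _ ?_
    · rw [← inf_iSup_eq]; exact le_inf le_rfl V.2
    · intro i j
      refine (homApp_res (sf i) inf_le_right inf_le_left _).symm.trans (Eq.trans ?_
        (homApp_res (sf j) inf_le_right inf_le_right _))
      rw [preMod_map_map_apply, preMod_map_map_apply]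
      exact hcomp i j _ _ _ _
  choose g hg hg' using key
  have hg'' : ∀ V p s, (∀ i, F.presheaf.map (homOfLE (inf_le_left : V.1 ⊓ U i ≤ V.1)).op s =
        homApp (sf i) (inf_le_right : V.1 ⊓ U i ≤ U i)
          (P.restrictₛₗ (homOfLE inf_le_left).op p)) → g V p = s :=
    fun V p s hs ↦ (hg' V p s hs).symm
  let G : homSections P F (iSup U) := ⟨fun V ↦
    { toFun := g V
      map_add' := fun p q ↦ hg'' _ _ _ fun i ↦ by
        rw [map_add, hg, hg, ← map_add]
        exact congrArg _ (map_add (P.restrictₛₗ _) p q).symm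
      map_smul' := fun r p ↦ hg'' _ _ _ fun i ↦ by
        dsimp only [RingHom.id_apply]
        rw [Scheme.Modules.map_smul, hg, ← map_smul]; congr 1
        exact (PresheafOfModules.map_smul P _ r p).symm }, by
    intro V W hWV p
    refine hg'' _ _ _ fun i ↦ ?_
    have h2 := homApp_res (sf i) (inf_le_right : V.1 ⊓ U i ≤ U i)
      (inf_le_inf_right (U i) hWV) (P.restrictₛₗ (homOfLE inf_le_left).op p)
    rw [preMod_map_map_apply, ← hg V p i, map_map_apply] at h2
    rw [preMod_map_map_apply, map_map_apply]
    exact h2.symm⟩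
  refine ⟨G, fun i ↦ ?_, fun G' hG' ↦ ?_⟩
  · refine homSections_ext (U := U i) fun V hV p ↦ ?_
    refine hg'' ⟨V, hV.trans (le_iSup U i)⟩ p _ fun j ↦ ?_
    rw [← homApp_res]
    exact hcomp i j _ _ _ _
  · change homSections P F (iSup U) at G'
    refine homSections_ext (U := iSup U) fun V hV p ↦ ?_
    refine (hg'' ⟨V, hV⟩ p _ fun i ↦ ?_).symm
    rw [← homApp_res, ← hG' i]; rfl

/-- The sheaf Hom `ℋom(P, F)` from a presheaf of modules `P` to a sheaf of modules `F`. It does not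
change if `P` is replaced by its sheafification. -/
def sheafHom (P : PreMod X) (F : X.Modules) : X.Modules where
  val := PresheafOfModules.ofPresheaf (R := X.ringCatSheaf.obj) (homPresheaf P F)
    fun _ _ i r φ ↦ homRestrict_smul P F i.unop.le r φ
  isSheaf := homPresheaf_isSheaf P F


/-- The dual sheaf `P^∨ = ℋom(P, 𝒪_X)`. -/
def dual (P : PreMod X) : X.Modules := sheafHom P (SheafOfModules.unit X.ringCatSheaf)

open MonoidalCategory in
/-- The tensor power presheaf `U ↦ P(U)^{⊗ m}`, the tensor product being over `𝒪_X(U)`. -/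
def tensorPower (P : PreMod X) : ℕ → PreMod X
  | 0 => 𝟙_ (PreMod X)
  | m + 1 => tensorPower P m ⊗ P

/-- The double dual `P^{∨∨}`. As duals only depend on the associated sheaf, this is the double
dual of the sheafification of `P`. -/
def reflexiveHull (P : PreMod X) : X.Modules := dual (dual P).val

/-- `F^{[m]} = (F^{⊗ m})^{∨∨}`. -/
def reflexivePower (F : X.Modules) (m : ℕ) : X.Modules := reflexiveHull (tensorPower F.val m)

/-! ### Divisors and twists -/

/-- The ideal of sections over `U` of the sheaf of ideals `I`. -/
def idealSections (I : X.IdealSheafData) (U : X.Opens) : Ideal Γ(X, U) :=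
  ⨅ (W : X.affineOpens) (hW : W.1 ≤ U), (I.ideal W).comap (X.presheaf.map (homOfLE hW).op).hom

lemma mem_idealSections {I : X.IdealSheafData} {U : X.Opens} {s : Γ(X, U)} :
    s ∈ idealSections I U ↔ ∀ (W : X.affineOpens) (hW : W.1 ≤ U),
      X.presheaf.map (homOfLE hW).op s ∈ I.ideal W := by
  simp [idealSections]

lemma map_mem_idealSections {I : X.IdealSheafData} {U V : X.Opens} (i : V ⟶ U) {s : Γ(X, U)}
    (hs : s ∈ idealSections I U) : X.presheaf.map i.op s ∈ idealSections I V := by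
  rw [mem_idealSections] at hs ⊢
  intro W hW
  have := hs W (hW.trans i.le)
  rw [← ConcreteCategory.comp_apply, ← Functor.map_comp]
  exact this

lemma idealSections_affine (I : X.IdealSheafData) (U : X.affineOpens) :
    idealSections I U.1 = I.ideal U := by
  refine le_antisymm (fun s hs ↦ ?_) fun s hs ↦ mem_idealSections.2 fun W hW ↦ ?_
  · simpa using mem_idealSections.1 hs U le_rfl
  · exact I.ideal_le_comap_ideal hW hs

/-- The sheaf of ideals `I`, as a presheaf of modules. -/
def idealPresheaf (I : X.IdealSheafData) : PreMod X :=
  PresheafOfModules.Submodule.toPresheafOfModules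
    (M := PresheafOfModules.unit (X.presheaf ⋙ forget₂ CommRingCat RingCat))
    { obj := fun U ↦ idealSections I U.unop
      map := fun i _ hs ↦ map_mem_idealSections i.unop hs }

/-- A closed subset `E`, with its reduced structure, is an (effective) Cartier divisor: its ideal
sheaf is locally generated by one nonzerodivisor. -/
def IsCartier (E : Closeds X) : Prop :=
  ∀ x : X, ∃ (W : X.affineOpens) (s : Γ(X, W.1)), x ∈ W.1 ∧ s ∈ nonZeroDivisors Γ(X, W.1) ∧
    (Scheme.IdealSheafData.vanishingIdeal E).ideal W = Ideal.span {s}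

/-- The twist `F(aE) = ℋom(𝒪_X(-aE), F)`, where `𝒪_X(-aE)` is the `a`-th power of the ideal sheaf
of the reduced closed subscheme `E`. When `E` is Cartier, `𝒪_X(-aE)` is invertible with inverse
`𝒪_X(aE)`, so this is `F ⊗ 𝒪_X(aE)`. -/
def twist (F : X.Modules) (E : Closeds X) (a : ℕ) : X.Modules :=
  sheafHom (idealPresheaf (Scheme.IdealSheafData.vanishingIdeal E ^ a)) F

/-! ### Birational morphisms -/

/-- A scheme is normal if all its local rings are integrally closed domains. -/
class IsNormal (X : Scheme.{u}) : Prop where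
  isDomain (x : X) : IsDomain (X.presheaf.stalk x)
  isIntegrallyClosed (x : X) : IsIntegrallyClosed (X.presheaf.stalk x)

/-- `f` is an isomorphism over a dense open subset of the target whose preimage is dense. -/
def IsBirational (f : Y ⟶ X) : Prop :=
  ∃ U : X.Opens, Dense (U : Set X) ∧ Dense (f ⁻¹ᵁ U : Set Y) ∧ IsIso (f ∣_ U)

/-- The largest open subset of `X` over which `f` is an isomorphism. Its preimage is the
complement of the exceptional locus of `f`. -/
def isoLocus (f : Y ⟶ X) : X.Opens := sSup {U | IsIso (f ∣_ U)}

/-- The reduced full exceptional divisor of a birational morphism `f`: the union of all prime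
divisors contained in the exceptional locus. These are the closures of the points of codimension
one in the exceptional locus. -/
def exceptionalDivisor (f : Y ⟶ X) : Closeds Y :=
  Closeds.closure {y | ringKrullDim (Y.presheaf.stalk y) = 1 ∧ f y ∉ isoLocus f}

/-! ### Dualizing sheaves -/

/-- A dualizing complex of a Noetherian ring `A`, represented by a bounded complex `I` of injective
modules: the cohomology is finitely generated and `A → RHom(I, I)` is an isomorphism. Here
`H^i RHom(I, I)` is the group of homotopy classes of maps `I → I[i]`. -/
structure IsDualizingComplex (A : Type u) [CommRing A] (I : CochainComplex (ModuleCat.{u} A) ℤ) :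
    Prop where
  bounded : ∃ a b : ℤ, ∀ i, i < a ∨ b < i → Limits.IsZero (I.X i)
  injective (i : ℤ) : Injective (I.X i)
  finite (i : ℤ) : Module.Finite A (I.homology i)
  faithful (a : A) : Nonempty (Homotopy (a • 𝟙 I) 0) → a = 0
  full (φ : I ⟶ I) : ∃ a : A, Nonempty (Homotopy φ (a • 𝟙 I))
  rigid (i : ℤ) (hi : i ≠ 0) (φ : I ⟶ I⟦i⟧) : Nonempty (Homotopy φ 0)

/-- A dualizing module of a Noetherian domain: the lowest nonzero cohomology module of a dualizing
complex. -/
def IsDualizingModule (A : Type u) [CommRing A] (M : ModuleCat.{u} A) : Prop :=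
  ∃ (I : CochainComplex (ModuleCat.{u} A) ℤ) (n : ℤ), IsDualizingComplex A I ∧
    (∀ i < n, Limits.IsZero (I.homology i)) ∧ ¬ Limits.IsZero (I.homology n) ∧
    Nonempty (M ≅ I.homology n)

/-- A dualizing sheaf on a Noetherian normal scheme: a quasi-coherent sheaf whose sections over any
integral affine open subset `U` form a dualizing module of `𝒪_X(U)`. The bottom cohomology sheaf
of a dualizing complex on a connected `X` has this property, as localization preserves dualizing
complexes and their lowest cohomology is supported everywhere. -/
structure IsDualizingSheaf (ω : X.Modules) : Prop where
  isQuasicoherent : ω.IsQuasicoherent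
  isDualizingModule (U : X.affineOpens) : IsDomain Γ(X, U.1) →
    IsDualizingModule Γ(X, U.1) (ModuleCat.of Γ(X, U.1) Γ(ω, U.1))

/-! ### The canonical sheaf of a scheme over a field -/

section
variable {R S T : Type u} [CommRing R] [CommRing S] [CommRing T]
  {M N L : Type u} [AddCommGroup M] [AddCommGroup N] [AddCommGroup L]
  [Module R M] [Module S N] [Module T L]

/-- The map of exterior powers induced by a semilinear map. -/
def exteriorMap {f : R →+* S} (g : M →ₛₗ[f] N) (n : ℕ) : ⋀[R]^n M →ₛₗ[f] ⋀[S]^n N :=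
  letI : Module R (⋀[S]^n N) := Module.compHom _ f
  let φ : M [⋀^Fin n]→ₗ[R] ⋀[S]^n N :=
    { toFun := fun x ↦ exteriorPower.ιMulti S n (fun i ↦ g (x i))
      map_update_add' := fun x i a b ↦ by
        have h (c : M) : (fun j ↦ g (Function.update x i c j)) =
            Function.update (fun j ↦ g (x j)) i (g c) := by
          funext j; by_cases hj : j = i
          · subst hj; simp
          · simp [hj]
        have e : ‹DecidableEq (Fin n)› = instDecidableEqFin n := Subsingleton.elim _ _
        subst e
        rw [h, h, h, map_add, AlternatingMap.map_update_add]
      map_update_smul' := fun x i r a ↦ by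
        have h (c : M) : (fun j ↦ g (Function.update x i c j)) =
            Function.update (fun j ↦ g (x j)) i (g c) := by
          funext j; by_cases hj : j = i
          · subst hj; simp
          · simp [hj]
        have e : ‹DecidableEq (Fin n)› = instDecidableEqFin n := Subsingleton.elim _ _
        subst e
        rw [h, h, map_smulₛₗ, AlternatingMap.map_update_smul]; rfl
      map_eq_zero_of_eq' := fun x i j h hij ↦
        AlternatingMap.map_eq_zero_of_eq _ _ (congrArg g h) hij }
  let ψ := exteriorPower.alternatingMapLinearEquiv φ
  { toFun := ψ
    map_add' := ψ.map_add
    map_smul' := ψ.map_smul }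

lemma exteriorMap_ιMulti {f : R →+* S} (g : M →ₛₗ[f] N) (n : ℕ) (x : Fin n → M) :
    exteriorMap g n (exteriorPower.ιMulti R n x) = exteriorPower.ιMulti S n (fun i ↦ g (x i)) :=
  letI : Module R (⋀[S]^n N) := Module.compHom _ f
  exteriorPower.alternatingMapLinearEquiv_apply_ιMulti _ _

lemma semilinear_ext {N' : Type u} [AddCommGroup N'] [Module S N'] {f : R →+* S} {n : ℕ}
    {φ ψ : ⋀[R]^n M →ₛₗ[f] N'}
    (h : ∀ x, φ (exteriorPower.ιMulti R n x) = ψ (exteriorPower.ιMulti R n x)) : φ = ψ :=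
  LinearMap.ext_on (exteriorPower.ιMulti_span R n M) (by rintro _ ⟨x, rfl⟩; exact h x)

lemma exteriorMap_of_id {f : R →+* R} (hf : f = RingHom.id R) (g : M →ₛₗ[f] M)
    (hg : ∀ m, g m = m) (n : ℕ) (x : ⋀[R]^n M) : exteriorMap g n x = x := by
  subst hf
  exact LinearMap.congr_fun (semilinear_ext (φ := exteriorMap g n) (ψ := LinearMap.id)
    fun x ↦ by simp [exteriorMap_ιMulti, hg]) x

lemma exteriorMap_of_comp {f : R →+* S} {f' : S →+* T} {f'' : R →+* T} (hf : f'' = f'.comp f)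
    (g : M →ₛₗ[f] N) (g' : N →ₛₗ[f'] L) (g'' : M →ₛₗ[f''] L) (hg : ∀ m, g'' m = g' (g m))
    (n : ℕ) (x : ⋀[R]^n M) :
    exteriorMap g'' n x = exteriorMap g' n (exteriorMap g n x) := by
  subst hf
  have : RingHomCompTriple f f' (f'.comp f) := ⟨rfl⟩
  exact LinearMap.congr_fun (semilinear_ext (φ := exteriorMap g'' n)
    (ψ := (exteriorMap g' n).comp (exteriorMap g n))
    fun x ↦ by simp [exteriorMap_ιMulti, hg]) x

end

/-- The underlying presheaf of abelian groups of `U ↦ ⋀ⁿ P(U)`. -/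
def exteriorPowerAb (P : PreMod X) (n : ℕ) : X.Opensᵒᵖ ⥤ Ab.{u} where
  obj U := AddCommGrpCat.of (⋀[Γ(X, U.unop)]^n (P.obj U))
  map {U V} i := AddCommGrpCat.ofHom
    (exteriorMap (f := (X.presheaf.map i).hom) (P.restrictₛₗ i) n).toAddMonoidHom
  map_id U := by
    refine AddCommGrpCat.hom_ext (AddMonoidHom.ext fun x ↦ ?_)
    exact exteriorMap_of_id (f := (X.presheaf.map (𝟙 U)).hom) (by simp) (P.restrictₛₗ (𝟙 U))
      (fun p ↦ by rw [PresheafOfModules.restrictₛₗ_apply, P.map_id]; rfl) n x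
  map_comp {U V W} i j := by
    refine AddCommGrpCat.hom_ext (AddMonoidHom.ext fun x ↦ ?_)
    exact exteriorMap_of_comp (f := (X.presheaf.map i).hom) (f' := (X.presheaf.map j).hom)
      (f'' := (X.presheaf.map (i ≫ j)).hom) (by simp) (P.restrictₛₗ i) (P.restrictₛₗ j)
      (P.restrictₛₗ (i ≫ j)) (fun p ↦ P.map_comp_apply i j p) n x

instance (P : PreMod X) (n : ℕ) (U : X.Opensᵒᵖ) :
    Module ((X.presheaf ⋙ forget₂ CommRingCat RingCat).obj U) ((exteriorPowerAb P n).obj U) :=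
  inferInstanceAs (Module Γ(X, U.unop) (⋀[Γ(X, U.unop)]^n (P.obj U)))

/-- The presheaf `U ↦ ⋀ⁿ P(U)`. -/
def exteriorPowerPresheaf (P : PreMod X) (n : ℕ) : PreMod X :=
  PresheafOfModules.ofPresheaf (R := X.presheaf ⋙ forget₂ CommRingCat RingCat)
    (exteriorPowerAb P n) fun _ _ i r x ↦
      (exteriorMap (f := (X.presheaf.map i).hom) (P.restrictₛₗ i) n).map_smulₛₗ r x

/-- The structure morphism `k → 𝒪_X` of a `k`-scheme, as a map of presheaves of rings. -/
def structureMap {k : Type u} [Field k] (π : X ⟶ Spec (.of k)) :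
    (Functor.const X.Opensᵒᵖ).obj (CommRingCat.of k) ⟶ X.presheaf where
  app U := (Scheme.ΓSpecIso (.of k)).inv ≫ π.appTop ≫ X.presheaf.map (homOfLE le_top).op
  naturality U V i := by
    dsimp
    simp only [Category.id_comp, Category.assoc, ← Functor.map_comp]
    rfl

/-- The presheaf `U ↦ Ω_{𝒪_X(U)/k}`, whose associated sheaf is `Ω_{X/k}`. -/
def differentials {k : Type u} [Field k] (π : X ⟶ Spec (.of k)) : PreMod X :=
  PresheafOfModules.DifferentialsConstruction.relativeDifferentials' (structureMap π)

/-- The canonical (dualizing) sheaf `ω_X = (⋀ⁿ Ω_{X/k})^{∨∨}` of a normal scheme `X` of finite type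
and of pure dimension `n` over a perfect field `k`. -/
def canonicalSheaf {k : Type u} [Field k] (π : X ⟶ Spec (.of k)) (n : ℕ) : X.Modules :=
  reflexiveHull (exteriorPowerPresheaf (differentials π) n)

end

end DirectImages

/-!
Let `U` be the isomorphism locus of `f`, `V = f⁻¹ U` and `E` the exceptional divisor. The two
sheaves to be compared agree over `U`, and everything else is a matter of extending sections over
small closed subsets.

* Duals of arbitrary sheaves on a normal Noetherian scheme have unique extensions of sections over
  closed subsets of codimension at least two (`bijOn_structureSheaf`, `BijOn.sheafHom`). On `X` the
  complement of `U` is such a subset: by the valuative criterion, the birational inverse of `f` is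
  defined near every point of codimension one (`mem_isoLocus_of_ringKrullDim_le_one`). So sections
  of the reflexive sheaf `H = ω_X^{[m]}` are the same over `N` and over `N ∩ U`.
* On `Y` the points of codimension at most one outside `V` lie on `E`. Hence a section over `V` of
  the reflexive sheaf `G = ω_Y^{[m]}` extends to the complement of `E`. Near a point of `E` choose a
  local equation `t` of `E`. As `G` is the dual of a sheaf of finite type, namely of the dual of
  `ω_Y^{⊗m}`, the section extends after multiplication with a power of `t`
  (`exists_extends_pow_smul`, `exists_extends_mulHom`), i.e. it is a section of `G(aE)` for large
  `a`. Sections of `G(aE)` are determined by their restrictions to `V`, which is dense.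
* Finitely many sections generate `H` locally, and `X` and `Y` are quasi-compact, so one `a` works
  for all sections of `H` (`exists_forall_nonempty_iso`). The isomorphism `H ≅ f_* G(aE)` over `U`
  then extends to `X` (`nonempty_iso_of_extends`): all values of the map extend, and a section of
  `f_* G(aE)` over `N` is determined by its restriction to `N ∩ U`, which extends in `H`.

About `ω_X` and `ω_Y` the argument uses only that they are of finite type and agree over `U`. For
dualizing sheaves the first fact is `IsDualizingSheaf.isFiniteType` and the second a hypothesis; for
canonical sheaves they are obtained from the sheaves of differentials by following finite
generation, and the comparison over `U`, through exterior powers, tensor powers and duals.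

Sections over `N ∩ V` that extend to `N`, sheaves of finite type and isomorphisms over `U` are all
treated on sections over open subsets, for presheaves of modules; this avoids sheafification of
tensor and exterior powers, as duals only depend on the associated sheaf.
-/

namespace DirectImages

noncomputable section

section

variable {X : Scheme.{u}}

/-! ### Restriction maps and gluing -/

/-- Restriction of functions to a smaller open subset. -/
def resO {U V : X.Opens} (h : V ≤ U) : Γ(X, U) →+* Γ(X, V) := (X.presheaf.map (homOfLE h).op).hom

/-- Restriction of sections of a presheaf of modules to a smaller open subset. -/
def resP (P : PreMod X) {U V : X.Opens} (h : V ≤ U) :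
    P.obj (op U) →ₛₗ[resO h] P.obj (op V) := P.restrictₛₗ (homOfLE h).op

/-- Restriction of sections of a sheaf of modules to a smaller open subset. -/
def res (F : X.Modules) {U V : X.Opens} (h : V ≤ U) : Γ(F, U) →ₛₗ[resO h] Γ(F, V) where
  toFun := F.presheaf.map (homOfLE h).op
  map_add' := map_add _
  map_smul' r s := F.map_smul (homOfLE h) r s

@[simp] lemma resO_self {U : X.Opens} (s : Γ(X, U)) : resO le_rfl s = s := by
  change X.presheaf.map (𝟙 (op U)) s = s
  simp

@[simp] lemma resO_resO {U V W : X.Opens} (h : V ≤ U) (h' : W ≤ V) (s : Γ(X, U)) :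
    resO h' (resO h s) = resO (h'.trans h) s := by
  simp only [resO]
  rw [← CommRingCat.comp_apply, ← Functor.map_comp]; rfl

@[simp] lemma resP_self (P : PreMod X) {U : X.Opens} (s : P.obj (op U)) :
    resP P le_rfl s = s := by
  change P.map (𝟙 (op U)) s = s
  rw [P.map_id]; rfl

@[simp] lemma resP_resP (P : PreMod X) {U V W : X.Opens} (h : V ≤ U) (h' : W ≤ V)
    (s : P.obj (op U)) : resP P h' (resP P h s) = resP P (h'.trans h) s :=
  preMod_map_map_apply P h h' s

@[simp] lemma res_self (F : X.Modules) {U : X.Opens} (s : Γ(F, U)) : res F le_rfl s = s := by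
  change F.presheaf.map (𝟙 (op U)) s = s
  simp

@[simp] lemma res_res (F : X.Modules) {U V W : X.Opens} (h : V ≤ U) (h' : W ≤ V)
    (s : Γ(F, U)) : res F h' (res F h s) = res F (h'.trans h) s :=
  map_map_apply F h h' s

/-- The structure sheaf as a sheaf of modules over itself. -/
abbrev structureSheaf (X : Scheme.{u}) : X.Modules := SheafOfModules.unit X.ringCatSheaf

lemma resP_homApp {P : PreMod X} {F : X.Modules} {U : X.Opens} (φ : homSections P F U)
    {V W : X.Opens} (hV : V ≤ U) (hWV : W ≤ V) (p : P.obj (op V)) :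
    homApp φ (hWV.trans hV) (resP P hWV p) = res F hWV (homApp φ hV p) :=
  homApp_res φ hV hWV p

lemma homApp_res_sheafHom {P : PreMod X} {F : X.Modules} {U V W : X.Opens} (hV : V ≤ U)
    (φ : homSections P F U) (hW : W ≤ V) (p : P.obj (op W)) :
    homApp (res (sheafHom P F) hV φ : homSections P F V) hW p = homApp φ (hW.trans hV) p := rfl

lemma homApp_smul {P : PreMod X} {F : X.Modules} {U W : X.Opens} (r : Γ(X, U))
    (φ : homSections P F U) (hW : W ≤ U) (p : P.obj (op W)) :
    homApp (r • φ) hW p = resO hW r • homApp φ hW p := rfl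

lemma homApp_add {P : PreMod X} {F : X.Modules} {U W : X.Opens}
    (φ ψ : homSections P F U) (hW : W ≤ U) (p : P.obj (op W)) :
    homApp (φ + ψ) hW p = homApp φ hW p + homApp ψ hW p := rfl

lemma homApp_zero {P : PreMod X} {F : X.Modules} {U W : X.Opens} (hW : W ≤ U) (p : P.obj (op W)) :
    homApp (0 : homSections P F U) hW p = 0 := rfl

/-- A homomorphism `P|_U ⟶ F|_U`, from its values. -/
def mkHom {P : PreMod X} {F : X.Modules} {U : X.Opens}
    (g : ∀ N : X.Opens, N ≤ U → P.obj (op N) → Γ(F, N))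
    (map_add : ∀ N hN p q, g N hN (p + q) = g N hN p + g N hN q)
    (map_smul : ∀ N hN (r : Γ(X, N)) p, g N hN (r • p) = r • g N hN p)
    (map_res : ∀ N hN M (hM : M ≤ N) p, g M (hM.trans hN) (resP P hM p) = res F hM (g N hN p)) :
    homSections P F U :=
  ⟨fun N ↦
    { toFun := g N.1 N.2
      map_add' := map_add N.1 N.2
      map_smul' := map_smul N.1 N.2 }, fun N M hMN p ↦ map_res N.1 N.2 M.1 hMN p⟩

/-- Sections of a sheaf which agree locally are equal. -/
lemma section_ext (F : X.Modules) {U : X.Opens} {s t : Γ(F, U)}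
    (h : ∀ y ∈ U, ∃ (V : X.Opens) (hV : V ≤ U), y ∈ V ∧ res F hV s = res F hV t) : s = t := by
  choose! V hV hy hst using h
  refine TopCat.Sheaf.eq_of_locally_eq' ⟨F.presheaf, F.isSheaf⟩ (fun y : U ↦ V y) U
    (fun y ↦ homOfLE (hV y y.2)) (fun y hyU ↦ Opens.mem_iSup.2 ⟨⟨y, hyU⟩, hy y hyU⟩) s t ?_
  exact fun y ↦ hst y y.2

/-- `F` has no nonzero sections over open subsets of `Z` that vanish on `V`. -/
def InjOn (F : X.Modules) (V Z : X.Opens) : Prop :=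
  ∀ N ≤ Z, ∀ s : Γ(F, N), res F (inf_le_left : N ⊓ V ≤ N) s = 0 → s = 0

lemma InjOn.eq {F : X.Modules} {V Z N : X.Opens} (h : InjOn F V Z) (hN : N ≤ Z) {s t : Γ(F, N)}
    (hst : res F (inf_le_left : N ⊓ V ≤ N) s = res F inf_le_left t) : s = t :=
  sub_eq_zero.1 (h N hN _ (by rw [map_sub, hst, sub_self]))

lemma InjOn.mono {F : X.Modules} {V Z Z' : X.Opens} (h : InjOn F V Z) (hZ : Z' ≤ Z) :
    InjOn F V Z' := fun N hN ↦ h N (hN.trans hZ)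

/-- The section `s` over `N ∩ V` extends to `N`. -/
def Extends (F : X.Modules) {V N : X.Opens} (s : Γ(F, N ⊓ V)) : Prop :=
  ∃ t : Γ(F, N), res F inf_le_left t = s

/-- Restriction of sections of `F` from `N` to `N ∩ V` is bijective for all open `N ⊆ Z`. -/
def BijOn (F : X.Modules) (V Z : X.Opens) : Prop :=
  InjOn F V Z ∧ ∀ N ≤ Z, ∀ s : Γ(F, N ⊓ V), Extends F s

/-- Extending a section is a local problem if extensions are unique. -/
lemma extends_of_local {F : X.Modules} {V N : X.Opens} (hF : InjOn F V N) (s : Γ(F, N ⊓ V))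
    (h : ∀ y ∈ N, ∃ (N' : X.Opens) (hN : N' ≤ N), y ∈ N' ∧
      Extends F (res F (inf_le_inf_right V hN) s)) : Extends F s := by
  choose N' hN hy t ht using h
  obtain ⟨u, hu, -⟩ := TopCat.Sheaf.existsUnique_gluing' ⟨F.presheaf, F.isSheaf⟩
    (fun y : N ↦ N' y y.2) N (fun y ↦ homOfLE (hN y y.2))
    (fun y hyN ↦ Opens.mem_iSup.2 ⟨⟨y, hyN⟩, hy y hyN⟩) (fun y ↦ t y y.2) (by
      intro y z
      change res F inf_le_left (t y y.2) = res F inf_le_right (t z z.2)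
      refine hF.eq (inf_le_left.trans (hN y y.2)) ?_
      have h1 := congrArg (res F (inf_le_inf_right V
        (inf_le_left : N' y y.2 ⊓ N' z z.2 ≤ N' y y.2))) (ht y y.2)
      have h2 := congrArg (res F (inf_le_inf_right V
        (inf_le_right : N' y y.2 ⊓ N' z z.2 ≤ N' z z.2))) (ht z z.2)
      simp only [res_res] at h1 h2 ⊢
      exact h1.trans h2.symm)
  refine ⟨u, section_ext F fun y hyN ↦ ⟨N' y hyN.1 ⊓ V, inf_le_inf_right V (hN y hyN.1),
    ⟨hy y hyN.1, hyN.2⟩, ?_⟩⟩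
  have h1 : res F (hN y hyN.1) u = t y hyN.1 := hu ⟨y, hyN.1⟩
  have h2 := ht y hyN.1
  rw [← h1] at h2
  rw [← h2]
  simp only [res_res]

/-- A homomorphism over `V` extends to `Z` as soon as all its values extend. -/
lemma exists_hom_extension {P : PreMod X} {F : X.Modules} {V Z : X.Opens} (hF : InjOn F V Z)
    (φ : homSections P F (Z ⊓ V))
    (h : ∀ (N : X.Opens) (hN : N ≤ Z) (p : P.obj (op N)),
      Extends F (homApp φ (inf_le_inf_right V hN) (resP P (inf_le_left : N ⊓ V ≤ N) p))) :
    Extends (sheafHom P F) (N := Z) (V := V) φ := by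
  choose g hg using h
  let G : homSections P F Z := mkHom g
    (fun N hN p q ↦ hF.eq hN (by rw [hg, map_add, map_add, map_add, hg, hg]))
    (fun N hN r p ↦ hF.eq hN (by rw [hg, map_smulₛₗ, map_smul, map_smulₛₗ, hg])) (by
      intro N hN M hMN p
      refine hF.eq (hMN.trans hN) ?_
      have := congrArg (res F (inf_le_inf_right V hMN)) (hg N hN p)
      rw [← resP_homApp] at this
      rw [hg]
      simp only [res_res, resP_resP] at this ⊢
      exact this.symm)
  refine ⟨G, homSections_ext fun N hN p ↦ ?_⟩
  change g N (hN.trans inf_le_left) p = homApp φ hN p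
  have h1 := hg N (hN.trans inf_le_left) p
  have h2 := resP_homApp φ hN (inf_le_left : N ⊓ V ≤ N) p
  exact hF.eq (hN.trans inf_le_left) (h1.trans h2)

lemma InjOn.sheafHom {F : X.Modules} {V Z : X.Opens} (hF : InjOn F V Z) (P : PreMod X) :
    InjOn (sheafHom P F) V Z := by
  intro N hN (φ : homSections P F N) hφ
  change homRestrict P F inf_le_left φ = 0 at hφ
  refine homSections_ext (φ := φ) (ψ := 0) fun M hM p ↦ hF.eq (hM.trans hN) ?_
  have h2 : homApp (homRestrict P F (inf_le_left : N ⊓ V ≤ N) φ)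
      (inf_le_inf_right V hM) (resP P inf_le_left p) = 0 := by
    rw [hφ, homApp_zero]
  rw [homApp_zero, map_zero, ← h2]
  exact (resP_homApp φ hM (inf_le_left : M ⊓ V ≤ M) p).symm

lemma BijOn.sheafHom {F : X.Modules} {V Z : X.Opens} (hF : BijOn F V Z) (P : PreMod X) :
    BijOn (sheafHom P F) V Z :=
  ⟨hF.1.sheafHom P, fun _ hN φ ↦ exists_hom_extension (hF.1.mono hN) φ
    fun N' hN' _ ↦ hF.2 N' (hN'.trans hN) _⟩

lemma Extends.add {F : X.Modules} {V N : X.Opens} {s t : Γ(F, N ⊓ V)} (hs : Extends F s)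
    (ht : Extends F t) : Extends F (s + t) := by
  obtain ⟨s, rfl⟩ := hs
  obtain ⟨t, rfl⟩ := ht
  exact ⟨s + t, map_add _ _ _⟩

lemma Extends.zero {F : X.Modules} {V N : X.Opens} : Extends F (0 : Γ(F, N ⊓ V)) :=
  ⟨0, map_zero _⟩

lemma Extends.smul {F : X.Modules} {V N : X.Opens} {s : Γ(F, N ⊓ V)} (hs : Extends F s)
    (r : Γ(X, N)) : Extends F (resO (inf_le_left : N ⊓ V ≤ N) r • s) := by
  obtain ⟨s, rfl⟩ := hs
  exact ⟨r • s, map_smulₛₗ _ _ _⟩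

lemma Extends.res {F : X.Modules} {V N N' : X.Opens} {s : Γ(F, N ⊓ V)} (hs : Extends F s)
    (hN : N' ≤ N) : Extends F (res F (inf_le_inf_right V hN) s) := by
  obtain ⟨s, rfl⟩ := hs
  exact ⟨DirectImages.res F hN s, by simp⟩

end

section

variable {X : Scheme.{u}}

/-! ### Extension of functions over subsets of codimension two -/

/-- In a Noetherian integrally closed domain, `b` divides `a` if it does so locally at all primes
of height one. An associated prime `(b : c)` of `A / b` has height one: if `c / b` does not map it
to itself, then `(c / b) q` is a unit locally at this prime for some `q` in it, so that it is
minimal over `q`; otherwise `c / b` is integral. -/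
lemma dvd_of_forall_height_eq_one {A : Type*} [CommRing A] [IsDomain A] [IsNoetherianRing A]
    [IsIntegrallyClosed A] {a b : A} (hb : b ≠ 0)
    (h : ∀ p : Ideal A, p.IsPrime → p.height = 1 → ∃ g ∉ p, b ∣ g * a) : b ∣ a := by
  by_contra hab
  have hx : Ideal.Quotient.mk (Ideal.span {b}) a ≠ 0 := by
    rwa [Ne, Ideal.Quotient.eq_zero_iff_dvd]
  obtain ⟨p, hp, hle⟩ := exists_le_isAssociatedPrime_of_isNoetherianRing A
    (Ideal.Quotient.mk (Ideal.span {b}) a) hx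
  rw [isAssociatedPrime_iff] at hp
  obtain ⟨hp, x, hpx⟩ := hp
  obtain ⟨c, rfl⟩ := Ideal.Quotient.mk_surjective x
  have hmem (c g : A) : g ∈ (⊥ : Submodule A (A ⧸ Ideal.span {b})).colon
      {Ideal.Quotient.mk (Ideal.span {b}) c} ↔ b ∣ g * c := by
    rw [Submodule.mem_colon_singleton, Submodule.mem_bot, ← Ideal.Quotient.eq_zero_iff_dvd]
    rfl
  have hpc (g : A) : g ∈ p ↔ b ∣ g * c := by rw [hpx, hmem]
  have hbp : b ∈ p := (hpc b).2 (dvd_mul_right _ _)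
  suffices hht : p.height = 1 by
    obtain ⟨g, hg, hga⟩ := h p hp hht
    exact hg (hle ((hmem a g).2 hga))
  by_cases hcase : ∃ q ∈ p, ∃ u ∉ p, q * c = b * u
  · obtain ⟨q, hq, u, hu, hqu⟩ := hcase
    have hmin : p ∈ (Ideal.span {q}).minimalPrimes := by
      refine ⟨⟨hp, by rwa [Ideal.span_singleton_le_iff_mem]⟩, fun p' hp' hle' r hr ↦ ?_⟩
      obtain ⟨hp'1, hp'2⟩ := hp'
      obtain ⟨v, hv⟩ := (hpc r).1 hr
      have h1 : u * r = q * v := by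
        apply mul_left_cancel₀ hb
        linear_combination (-r) * hqu + q * hv
      have h2 : u * r ∈ p' := by
        rw [h1]; exact Ideal.mul_mem_right _ _ (hp'2 (Ideal.mem_span_singleton_self q))
      exact (hp'1.mem_or_mem h2).resolve_left fun h3 ↦ hu (hle' h3)
    refine le_antisymm
      (Ideal.height_le_one_of_isPrincipal_of_mem_minimalPrimes (Ideal.span {q}) p hmin) ?_
    rw [Order.one_le_iff_pos, pos_iff_ne_zero]
    intro h0
    have h1 := Ideal.height_eq_zero_iff.1 h0
    rw [IsDomain.minimalPrimes_eq_singleton_bot] at h1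
    exact hb (by simpa [Set.mem_singleton_iff.1 h1] using hbp)
  · exfalso
    push Not at hcase
    let K := FractionRing A
    let : Field K := inferInstance
    have hbK : algebraMap A K b ≠ 0 := by simpa using hb
    have hint : IsIntegral A (algebraMap A K c / algebraMap A K b) := by
      refine isIntegral_of_smul_mem_submodule (Submodule.map (Algebra.linearMap A K) p) ?_ ?_ _ ?_
      · rw [Submodule.ne_bot_iff]
        exact ⟨algebraMap A K b, ⟨b, hbp, rfl⟩, hbK⟩
      · exact (IsNoetherian.noetherian p).map _
      · rintro _ ⟨q, hq, rfl⟩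
        obtain ⟨u, hu⟩ := (hpc q).1 hq
        refine ⟨u, ?_, ?_⟩
        · by_contra hup
          exact hcase q hq u hup hu
        · have := congrArg (algebraMap A K) hu
          rw [map_mul, map_mul] at this
          simp only [Algebra.linearMap_apply, smul_eq_mul]
          rw [div_mul_eq_mul_div, eq_div_iff hbK, mul_comm _ (algebraMap A K q), this, mul_comm]
    obtain ⟨y, hy⟩ := IsIntegrallyClosed.algebraMap_eq_of_integral hint
    refine hp.ne_top ((Ideal.eq_top_iff_one p).2 ((hpc 1).2 ⟨y, ?_⟩))
    apply IsFractionRing.injective A K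
    rw [one_mul, map_mul, hy, mul_div_cancel₀ _ hbK]

instance [IsNormal X] (x : X) : IsDomain (X.presheaf.stalk x) := IsNormal.isDomain x

instance [IsNormal X] (x : X) : IsIntegrallyClosed (X.presheaf.stalk x) :=
  IsNormal.isIntegrallyClosed x

instance (priority := low) [IsNormal X] : IsReduced X := isReduced_of_isReduced_stalk X

lemma exists_isAffineOpen_isDomain [IsLocallyNoetherian X] [IsNormal X] {N : X.Opens} {x : X}
    (hx : x ∈ N) :
    ∃ Z : X.Opens, IsAffineOpen Z ∧ IsDomain Γ(X, Z) ∧ x ∈ Z ∧ Z ≤ N := by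
  obtain ⟨Z, hxZ, hZ, hZN, hinj⟩ := X.exists_le_and_germ_injective x N hx
  exact ⟨Z, hZ, Function.Injective.isDomain (X.presheaf.germ Z x hxZ).hom hinj, hxZ, hZN⟩

lemma fromSpec_mem {Z : X.Opens} (hZ : IsAffineOpen Z) (p : PrimeSpectrum Γ(X, Z)) :
    hZ.fromSpec p ∈ Z := by
  have : hZ.fromSpec p ∈ Set.range hZ.fromSpec := ⟨p, rfl⟩
  rwa [hZ.range_fromSpec] at this

lemma fromSpec_mem_basicOpen {Z : X.Opens} (hZ : IsAffineOpen Z) (p : PrimeSpectrum Γ(X, Z))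
    (g : Γ(X, Z)) : hZ.fromSpec p ∈ X.basicOpen g ↔ g ∉ p.asIdeal := by
  change p ∈ hZ.fromSpec ⁻¹ᵁ X.basicOpen g ↔ _
  rw [hZ.fromSpec_preimage_basicOpen]
  rfl

lemma ringKrullDim_stalk_fromSpec {Z : X.Opens} (hZ : IsAffineOpen Z)
    (p : PrimeSpectrum Γ(X, Z)) :
    ringKrullDim (X.presheaf.stalk (hZ.fromSpec p)) = p.asIdeal.height := by
  let : Algebra Γ(X, Z) (X.presheaf.stalk (hZ.fromSpec p)) :=
    TopCat.Presheaf.algebra_section_stalk X.presheaf ⟨hZ.fromSpec p, fromSpec_mem hZ p⟩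
  have : IsLocalization.AtPrime (X.presheaf.stalk (hZ.fromSpec p)) p.asIdeal :=
    hZ.isLocalization_stalk' p (fromSpec_mem hZ p)
  exact IsLocalization.AtPrime.ringKrullDim_eq_height p.asIdeal _

lemma isIntegrallyClosed_of_isAffineOpen [IsNormal X] {Z : X.Opens} (hZ : IsAffineOpen Z)
    [IsDomain Γ(X, Z)] : IsIntegrallyClosed Γ(X, Z) := by
  refine IsIntegrallyClosed.of_localization_maximal fun p _ hp ↦ ?_
  let y : PrimeSpectrum Γ(X, Z) := ⟨p, hp.isPrime⟩
  let : Algebra Γ(X, Z) (X.presheaf.stalk (hZ.fromSpec y)) :=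
    TopCat.Presheaf.algebra_section_stalk X.presheaf ⟨hZ.fromSpec y, fromSpec_mem hZ y⟩
  have : IsLocalization.AtPrime (X.presheaf.stalk (hZ.fromSpec y)) p :=
    hZ.isLocalization_stalk' y (fromSpec_mem hZ y)
  exact .of_equiv (IsLocalization.algEquiv p.primeCompl (X.presheaf.stalk (hZ.fromSpec y))
    (Localization.AtPrime p)).toRingEquiv

/-- A section over a basic open subset is, up to a power of the denominator, a restriction. -/
lemma exists_resO_eq_pow_mul {Z : X.Opens} (hZ : IsAffineOpen Z) (t : Γ(X, Z))
    (s : Γ(X, X.basicOpen t)) :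
    ∃ (n : ℕ) (a : Γ(X, Z)),
      resO (X.basicOpen_le t) a = resO (X.basicOpen_le t) t ^ n * s := by
  have := hZ.isLocalization_basicOpen t
  obtain ⟨n, a, h⟩ := IsLocalization.Away.surj t s
  exact ⟨n, a, by rw [mul_comm]; exact h.symm⟩

lemma isUnit_resO {Z W : X.Opens} (t : Γ(X, Z)) (h : W ≤ X.basicOpen t) :
    IsUnit (resO (h.trans (X.basicOpen_le t)) t) := by
  have h1 : IsUnit (resO (X.basicOpen_le t) t) := RingedSpace.isUnit_res_basicOpen _ t
  have := h1.map (resO h)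
  rwa [resO_resO] at this

/-- On a reduced scheme, functions that vanish on a dense open subset are zero. -/
lemma injOn_structureSheaf [IsReduced X] {V Z : X.Opens}
    (h : ∀ N ≤ Z, N ⊓ V = ⊥ → N = ⊥) : InjOn (structureSheaf X) V Z := by
  intro N hN (s : Γ(X, N)) (hs : resO inf_le_left s = 0)
  refine eq_zero_of_basicOpen_eq_bot s (h _ ((X.basicOpen_le s).trans hN) ?_)
  have h1 : X.basicOpen (resO (inf_le_left : N ⊓ V ≤ N) s) = (N ⊓ V) ⊓ X.basicOpen s :=
    X.basicOpen_res s (homOfLE inf_le_left).op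
  rw [hs, Scheme.basicOpen_zero] at h1
  rw [eq_bot_iff, h1]
  exact le_inf (inf_le_inf_right V (X.basicOpen_le s)) inf_le_left

lemma injOn_structureSheaf_basicOpen {Z : X.Opens} [IsReduced X] (hZ : IsAffineOpen Z)
    [IsDomain Γ(X, Z)] {t : Γ(X, Z)} (ht : t ≠ 0) :
    InjOn (structureSheaf X) (X.basicOpen t) Z := by
  refine injOn_structureSheaf fun N hN hNt ↦ ?_
  by_contra hne
  obtain ⟨y, hy⟩ := (Opens.ne_bot_iff_nonempty N).1 hne
  obtain ⟨g, hgN, hyg⟩ := hZ.exists_basicOpen_le ⟨y, hy⟩ (hN hy)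
  have h1 : X.basicOpen (g * t) = ⊥ := by
    rw [Scheme.basicOpen_mul, eq_bot_iff, ← hNt]
    exact inf_le_inf_right _ hgN
  have h2 := eq_zero_of_basicOpen_eq_bot _ h1
  obtain rfl := (mul_eq_zero.1 h2).resolve_right ht
  rw [Scheme.basicOpen_zero] at hyg
  exact hyg

lemma injOn_structureSheaf_of_codim [IsLocallyNoetherian X] [IsNormal X] {V Z : X.Opens}
    (h : ∀ y ∈ Z, ringKrullDim (X.presheaf.stalk y) ≤ 1 → y ∈ V) :
    InjOn (structureSheaf X) V Z := by
  refine injOn_structureSheaf fun N hN hNV ↦ ?_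
  by_contra hne
  obtain ⟨y, hy⟩ := (Opens.ne_bot_iff_nonempty N).1 hne
  obtain ⟨Z', hZ', _, hyZ', hZ'N⟩ := exists_isAffineOpen_isDomain hy
  let η : PrimeSpectrum Γ(X, Z') := ⊥
  have hη := fromSpec_mem hZ' η
  have : hZ'.fromSpec η ∈ N ⊓ V := ⟨hZ'N hη, h _ (hN (hZ'N hη)) (by
    rw [ringKrullDim_stalk_fromSpec]
    change ((⊥ : Ideal Γ(X, Z')).height : WithBot ℕ∞) ≤ 1
    rw [Ideal.height_bot]; exact zero_le_one)⟩
  rw [hNV] at this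
  exact this

/-- Functions on a normal Noetherian scheme extend over closed subsets of codimension at least
two. -/
lemma bijOn_structureSheaf [IsLocallyNoetherian X] [IsNormal X] {V Z : X.Opens}
    (h : ∀ y ∈ Z, ringKrullDim (X.presheaf.stalk y) ≤ 1 → y ∈ V) :
    BijOn (structureSheaf X) V Z := by
  refine ⟨injOn_structureSheaf_of_codim h, fun N hN s ↦
    extends_of_local ((injOn_structureSheaf_of_codim h).mono hN) s fun y hy ↦ ?_⟩
  obtain ⟨A, hA, _, hyA, hAN⟩ := exists_isAffineOpen_isDomain hy
  refine ⟨A, hAN, hyA, ?_⟩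
  generalize hs' : res (structureSheaf X) (inf_le_inf_right V hAN) s = s'
  change Γ(X, A ⊓ V) at s'
  have _ : IsNoetherianRing Γ(X, A) := IsLocallyNoetherian.component_noetherian ⟨A, hA⟩
  have _ := isIntegrallyClosed_of_isAffineOpen hA
  have key (p : PrimeSpectrum Γ(X, A)) (hp : p.asIdeal.height ≤ 1) :
      ∃ g ∉ p.asIdeal, ∃ hg : X.basicOpen g ≤ A ⊓ V, ∃ (n : ℕ) (d : Γ(X, A)),
        resO (X.basicOpen_le g) d = resO (X.basicOpen_le g) g ^ n * resO hg s' := by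
    have hmem := fromSpec_mem hA p
    have hV : hA.fromSpec p ∈ A ⊓ V := ⟨hmem, h _ (hN (hAN hmem)) (by
      rw [ringKrullDim_stalk_fromSpec]; exact_mod_cast hp)⟩
    obtain ⟨g, hg, hgp⟩ := hA.exists_basicOpen_le ⟨_, hV⟩ hmem
    obtain ⟨n, d, hd⟩ := exists_resO_eq_pow_mul hA g (resO hg s')
    exact ⟨g, (fromSpec_mem_basicOpen hA p g).1 hgp, hg, n, d, hd⟩
  obtain ⟨b, hb, hbV, n, a, ha⟩ := key ⊥ (by
    change (⊥ : Ideal Γ(X, A)).height ≤ 1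
    rw [Ideal.height_bot]; exact zero_le_one)
  replace hb : b ≠ 0 := hb
  have hdvd : b ^ n ∣ a := by
    refine dvd_of_forall_height_eq_one (pow_ne_zero n hb) fun p hp hp1 ↦ ?_
    obtain ⟨g, hg, hgV, k, d, hd⟩ := key ⟨p, hp⟩ hp1.le
    refine ⟨g ^ k, fun hgk ↦ hg (hp.mem_of_pow_mem k hgk), d, ?_⟩
    have hg0 : g ≠ 0 := by rintro rfl; exact hg (zero_mem _)
    refine (injOn_structureSheaf_basicOpen hA (mul_ne_zero hg0 hb)).eq le_rfl ?_
    change resO inf_le_left (g ^ k * a) = resO inf_le_left (b ^ n * d)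
    have h1 : A ⊓ X.basicOpen (g * b) ≤ X.basicOpen g := by
      rw [Scheme.basicOpen_mul]; exact inf_le_right.trans inf_le_left
    have h2 : A ⊓ X.basicOpen (g * b) ≤ X.basicOpen b := by
      rw [Scheme.basicOpen_mul]; exact inf_le_right.trans inf_le_right
    have e1 := congrArg (resO h1) hd
    have e2 := congrArg (resO h2) ha
    simp only [map_mul, map_pow, resO_resO] at e1 e2 ⊢
    rw [e1, e2]
    ring
  obtain ⟨c, rfl⟩ := hdvd
  refine ⟨c, (injOn_structureSheaf_basicOpen hA hb).eq inf_le_left ?_⟩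
  change resO inf_le_left (resO inf_le_left c) = resO inf_le_left s'
  have h2 : (A ⊓ V) ⊓ X.basicOpen b ≤ X.basicOpen b := inf_le_right
  have e2 := congrArg (resO h2) ha
  simp only [map_mul, map_pow, resO_resO] at e2 ⊢
  exact ((isUnit_resO b h2).pow n).mul_left_cancel e2

end

section

variable {X : Scheme.{u}}

/-! ### Presheaves of modules of finite type -/

/-- Around `y`, the section `q` is a linear combination of restrictions of elements of `S`. -/
def LocallyInSpan (P : PreMod X) {N : X.Opens} (S : Set (P.obj (op N))) {N' : X.Opens}
    (h : N' ≤ N) (q : P.obj (op N')) (y : X) : Prop :=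
  ∃ (M : X.Opens) (hM : M ≤ N'), y ∈ M ∧
    resP P hM q ∈ Submodule.span Γ(X, M) (resP P (hM.trans h) '' S)

/-- Every section of `P` over an open subset of `N` is locally a linear combination of elements
of `S`, i.e. `S` generates the sheaf associated with `P` over `N`. -/
def GeneratesLocally (P : PreMod X) {N : X.Opens} (S : Set (P.obj (op N))) : Prop :=
  ∀ (N' : X.Opens) (h : N' ≤ N) (q : P.obj (op N')), ∀ y ∈ N', LocallyInSpan P S h q y

/-- The sheaf associated with `P` is of finite type. -/
def IsFiniteType (P : PreMod X) : Prop :=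
  ∀ x : X, ∃ N : X.Opens, x ∈ N ∧ ∃ S : Set (P.obj (op N)), S.Finite ∧ GeneratesLocally P S

lemma image_resP_self (P : PreMod X) {N : X.Opens} (S : Set (P.obj (op N))) :
    resP P le_rfl '' S = S := by simp

lemma resP_mem_span {P : PreMod X} {N M M' : X.Opens} {S : Set (P.obj (op N))} {h : M ≤ N}
    (h' : M' ≤ M) {q : P.obj (op M)} (hq : q ∈ Submodule.span Γ(X, M) (resP P h '' S)) :
    resP P h' q ∈ Submodule.span Γ(X, M') (resP P (h'.trans h) '' S) := by
  induction hq using Submodule.span_induction with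
  | mem x hx =>
    obtain ⟨s, hs, rfl⟩ := hx
    rw [resP_resP]
    exact Submodule.subset_span ⟨s, hs, rfl⟩
  | zero => rw [map_zero]; exact zero_mem _
  | add x y _ _ hx hy => rw [map_add]; exact add_mem hx hy
  | smul a x _ hx => rw [map_smulₛₗ]; exact Submodule.smul_mem _ _ hx

section LocallyInSpan

variable {P : PreMod X} {N N' : X.Opens} {S : Set (P.obj (op N))} {h : N' ≤ N}
  {q q' : P.obj (op N')} {y : X}

lemma LocallyInSpan.add (hq : LocallyInSpan P S h q y) (hq' : LocallyInSpan P S h q' y) :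
    LocallyInSpan P S h (q + q') y := by
  obtain ⟨M, hM, hy, hq⟩ := hq
  obtain ⟨M', hM', hy', hq'⟩ := hq'
  refine ⟨M ⊓ M', inf_le_left.trans hM, ⟨hy, hy'⟩, ?_⟩
  rw [map_add]
  have h1 := resP_mem_span (inf_le_left : M ⊓ M' ≤ M) hq
  have h2 := resP_mem_span (inf_le_right : M ⊓ M' ≤ M') hq'
  rw [resP_resP] at h1 h2
  exact add_mem h1 h2

lemma LocallyInSpan.zero (hy : y ∈ N') : LocallyInSpan P S h 0 y :=
  ⟨N', le_rfl, hy, by rw [map_zero]; exact zero_mem _⟩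

lemma LocallyInSpan.smul (hq : LocallyInSpan P S h q y) (r : Γ(X, N')) :
    LocallyInSpan P S h (r • q) y := by
  obtain ⟨M, hM, hy, hq⟩ := hq
  exact ⟨M, hM, hy, by rw [map_smulₛₗ]; exact Submodule.smul_mem _ _ hq⟩

end LocallyInSpan

lemma GeneratesLocally.res {P : PreMod X} {N N' : X.Opens} {S : Set (P.obj (op N))}
    (hS : GeneratesLocally P S) (h : N' ≤ N) : GeneratesLocally P (resP P h '' S) := by
  intro M hM q y hy
  obtain ⟨M', hM', hy', hq⟩ := hS M (hM.trans h) q y hy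
  refine ⟨M', hM', hy', ?_⟩
  rw [Set.image_image]
  simpa only [resP_resP] using hq

/-- The generators may be taken over an integral affine open subset. -/
lemma IsFiniteType.exists_isAffineOpen [IsLocallyNoetherian X] [IsNormal X] {P : PreMod X}
    (hP : IsFiniteType P) {N : X.Opens} {x : X} (hx : x ∈ N) :
    ∃ Z : X.Opens, IsAffineOpen Z ∧ IsDomain Γ(X, Z) ∧ x ∈ Z ∧ Z ≤ N ∧
      ∃ S : Set (P.obj (op Z)), S.Finite ∧ GeneratesLocally P S := by
  obtain ⟨N', hx', S, hfin, hS⟩ := hP x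
  obtain ⟨Z, hZ, hd, hxZ, hZN⟩ := exists_isAffineOpen_isDomain (N := N ⊓ N') ⟨hx, hx'⟩
  exact ⟨Z, hZ, hd, hxZ, hZN.trans inf_le_left, _, hfin.image _,
    hS.res (hZN.trans inf_le_right)⟩

lemma isFiniteType_of_isAffineOpen [IsLocallyNoetherian X] [IsNormal X] {P : PreMod X}
    (h : ∀ Z : X.Opens, IsAffineOpen Z → IsDomain Γ(X, Z) →
      ∃ S : Set (P.obj (op Z)), S.Finite ∧ GeneratesLocally P S) : IsFiniteType P := by
  intro x
  obtain ⟨Z, hZ, hd, hxZ, -⟩ := exists_isAffineOpen_isDomain (Opens.mem_top x)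
  exact ⟨Z, hxZ, h Z hZ hd⟩

/-- If sections over basic open subsets of an affine open subset `Z` are restrictions up to
denominators, generators of `P(Z)` generate locally. -/
lemma generatesLocally_of_span_eq_top {P : PreMod X} {Z : X.Opens} (hZ : IsAffineOpen Z)
    {S : Set (P.obj (op Z))} (hS : Submodule.span Γ(X, Z) S = ⊤)
    (h : ∀ (t : Γ(X, Z)) (q : P.obj (op (X.basicOpen t))), ∃ (n : ℕ) (m : P.obj (op Z)),
      resP P (X.basicOpen_le t) m = resO (X.basicOpen_le t) t ^ n • q) :
    GeneratesLocally P S := by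
  intro N hN q y hy
  obtain ⟨t, htN, hyt⟩ := hZ.exists_basicOpen_le ⟨y, hy⟩ (hN hy)
  obtain ⟨n, m, hm⟩ := h t (resP P htN q)
  refine ⟨_, htN, hyt, ?_⟩
  have h1 : m ∈ Submodule.span Γ(X, Z) (resP P le_rfl '' S) := by
    rw [image_resP_self, hS]; trivial
  have h2 := resP_mem_span (X.basicOpen_le t) h1
  rw [hm] at h2
  obtain ⟨v, hv⟩ := (isUnit_resO t le_rfl).pow n
  rw [← hv] at h2
  exact (Submodule.smul_mem_iff_of_isUnit _ v.isUnit).1 h2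

/-! ### Tensor powers -/

section Tensor

open MonoidalCategory TensorProduct

/-- The pairing `P(N) × Q(N) → (P ⊗ Q)(N)`. -/
def tmulP (P Q : PreMod X) (N : X.Opens) :
    P.obj (op N) →ₗ[Γ(X, N)] Q.obj (op N) →ₗ[Γ(X, N)] (P ⊗ Q : PreMod X).obj (op N) :=
  TensorProduct.mk Γ(X, N) (P.obj (op N)) (Q.obj (op N))

lemma resP_tmulP (P Q : PreMod X) {N N' : X.Opens} (h : N' ≤ N) (p : P.obj (op N))
    (q : Q.obj (op N)) :
    resP (P ⊗ Q : PreMod X) h (tmulP P Q N p q) = tmulP P Q N' (resP P h p) (resP Q h q) :=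
  PresheafOfModules.Monoidal.tensorObj_map_tmul (homOfLE h).op p q

lemma tensor_induction (P Q : PreMod X) {N : X.Opens}
    {motive : (P ⊗ Q : PreMod X).obj (op N) → Prop} (zero : motive 0)
    (tmul : ∀ p q, motive (tmulP P Q N p q))
    (add : ∀ x y, motive x → motive y → motive (x + y)) (x) : motive x :=
  TensorProduct.induction_on (motive := motive) (R := Γ(X, N)) (M := P.obj (op N))
    (N := Q.obj (op N)) x zero tmul add

lemma IsFiniteType.tensor {P Q : PreMod X} (hP : IsFiniteType P) (hQ : IsFiniteType Q) :
    IsFiniteType (P ⊗ Q : PreMod X) := by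
  intro x
  obtain ⟨N₁, hx₁, S₁, hfin₁, hS₁⟩ := hP x
  obtain ⟨N₂, hx₂, S₂, hfin₂, hS₂⟩ := hQ x
  refine ⟨N₁ ⊓ N₂, ⟨hx₁, hx₂⟩, Set.image2 (fun p q ↦ tmulP P Q _ p q)
    (resP P inf_le_left '' S₁) (resP Q inf_le_right '' S₂),
    .image2 _ (hfin₁.image _) (hfin₂.image _), ?_⟩
  replace hS₁ := hS₁.res (inf_le_left : N₁ ⊓ N₂ ≤ N₁)
  replace hS₂ := hS₂.res (inf_le_right : N₁ ⊓ N₂ ≤ N₂)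
  intro N hN q y hy
  induction q using tensor_induction with
  | zero => exact .zero hy
  | add _ _ h h' => exact h.add h'
  | tmul p q =>
    obtain ⟨M₁, hM₁, hy₁, h₁⟩ := hS₁ N hN p y hy
    obtain ⟨M₂, hM₂, hy₂, h₂⟩ := hS₂ N hN q y hy
    refine ⟨M₁ ⊓ M₂, inf_le_left.trans hM₁, ⟨hy₁, hy₂⟩, ?_⟩
    replace h₁ := resP_mem_span (inf_le_left : M₁ ⊓ M₂ ≤ M₁) h₁
    replace h₂ := resP_mem_span (inf_le_right : M₁ ⊓ M₂ ≤ M₂) h₂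
    rw [resP_resP] at h₁ h₂
    rw [resP_tmulP]
    have := Submodule.apply_mem_map₂ (tmulP P Q (M₁ ⊓ M₂)) h₁ h₂
    rw [Submodule.map₂_span_span] at this
    refine Submodule.span_mono ?_ this
    rintro _ ⟨_, ⟨a, ha, rfl⟩, _, ⟨b, hb, rfl⟩, rfl⟩
    exact ⟨_, ⟨a, ha, b, hb, rfl⟩, resP_tmulP _ _ _ _ _⟩

lemma isFiniteType_unit : IsFiniteType (𝟙_ (PreMod X)) := by
  intro x
  let e : (𝟙_ (PreMod X)).obj (op ⊤) := (1 : Γ(X, ⊤))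
  refine ⟨⊤, trivial, {e}, Set.finite_singleton _, fun N h q y hy ↦ ⟨N, le_rfl, hy, ?_⟩⟩
  let r : Γ(X, N) := q
  have hq : r • resP (𝟙_ (PreMod X)) h e = q := by
    change r * resO h 1 = r
    rw [map_one, mul_one]
  rw [resP_self, ← hq]
  exact Submodule.smul_mem _ _ (Submodule.subset_span ⟨e, rfl, rfl⟩)

lemma IsFiniteType.tensorPower {P : PreMod X} (hP : IsFiniteType P) (m : ℕ) :
    IsFiniteType (tensorPower P m) := by
  induction m with
  | zero => exact isFiniteType_unit
  | succ m ih => exact ih.tensor hP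

end Tensor

/-! ### Exterior powers -/

lemma ιMulti_mem_span {R M : Type*} [CommRing R] [AddCommGroup M] [Module R M] {n : ℕ}
    {A : Set M} {x : Fin n → M} (hx : ∀ i, x i ∈ Submodule.span R A) :
    exteriorPower.ιMulti R n x ∈
      Submodule.span R (exteriorPower.ιMulti R n '' {a | Set.range a ⊆ A}) := by
  let B := Submodule.span R A
  have h1 := exteriorPower.ιMulti_span_of_span R n B
    (s := ((↑) : B → M) ⁻¹' A) (Submodule.span_span_coe_preimage)
  have h2 : exteriorPower.ιMulti R n (fun i ↦ (⟨x i, hx i⟩ : B)) ∈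
      (⊤ : Submodule R (⋀[R]^n B)) := trivial
  rw [← h1] at h2
  have h3 := Submodule.mem_map_of_mem (f := exteriorPower.map n B.subtype) h2
  rw [Submodule.map_span, exteriorPower.map_apply_ιMulti] at h3
  refine Submodule.span_mono ?_ h3
  rintro _ ⟨_, ⟨a, ha, rfl⟩, rfl⟩
  refine ⟨fun i ↦ a i, ?_, (exteriorPower.map_apply_ιMulti B.subtype a).symm⟩
  rintro _ ⟨i, rfl⟩
  exact ha ⟨i, rfl⟩

/-- The exterior product `P(N)ⁿ → (⋀ⁿ P)(N)`. -/
def wedgeP (P : PreMod X) (n : ℕ) (N : X.Opens) :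
    P.obj (op N) [⋀^Fin n]→ₗ[Γ(X, N)] (exteriorPowerPresheaf P n).obj (op N) :=
  exteriorPower.ιMulti Γ(X, N) n

lemma wedgeP_mem_span {P : PreMod X} {n : ℕ} {N : X.Opens} {A : Set (P.obj (op N))}
    {x : Fin n → P.obj (op N)} (hx : ∀ i, x i ∈ Submodule.span Γ(X, N) A) :
    wedgeP P n N x ∈ Submodule.span Γ(X, N) (wedgeP P n N '' {a | Set.range a ⊆ A}) :=
  ιMulti_mem_span hx

lemma resP_wedgeP (P : PreMod X) (n : ℕ) {N N' : X.Opens} (h : N' ≤ N)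
    (x : Fin n → P.obj (op N)) :
    resP (exteriorPowerPresheaf P n) h (wedgeP P n N x) =
      wedgeP P n N' (fun i ↦ resP P h (x i)) :=
  exteriorMap_ιMulti (f := (X.presheaf.map (homOfLE h).op).hom) (P.restrictₛₗ (homOfLE h).op) n x

lemma IsFiniteType.exteriorPower {P : PreMod X} (hP : IsFiniteType P) (n : ℕ) :
    IsFiniteType (exteriorPowerPresheaf P n) := by
  intro x
  obtain ⟨N, hx, S, hfin, hS⟩ := hP x
  refine ⟨N, hx, wedgeP P n N '' {a | Set.range a ⊆ S}, Set.Finite.image _ ?_, ?_⟩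
  · have : {a : Fin n → P.obj (op N) | Set.range a ⊆ S} = Set.pi Set.univ fun _ ↦ S := by
      ext a; simp [Set.range_subset_iff, Set.mem_pi]
    rw [this]
    exact Set.Finite.pi fun _ ↦ hfin
  intro N' hN q y hy
  have hq : q ∈ Submodule.span Γ(X, N') (Set.range (wedgeP P n N')) := by
    have : Submodule.span Γ(X, N') (Set.range (wedgeP P n N')) = ⊤ :=
      exteriorPower.ιMulti_span Γ(X, N') n (P.obj (op N'))
    rw [this]; trivial
  induction hq using Submodule.span_induction with
  | zero => exact .zero hy
  | add _ _ _ _ h h' => exact h.add h'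
  | smul r _ _ h => exact h.smul r
  | mem q hq =>
    obtain ⟨x, rfl⟩ := hq
    choose M hM hyM hxM using fun i ↦ hS N' hN (x i) y hy
    obtain ⟨W, hWN, hyW, hW⟩ : ∃ W : X.Opens, ∃ _ : W ≤ N', y ∈ W ∧ ∀ i, W ≤ M i := by
      refine ⟨Finset.univ.inf M ⊓ N', inf_le_right, ⟨?_, hy⟩,
        fun i ↦ inf_le_left.trans (Finset.inf_le (Finset.mem_univ i))⟩
      rw [Opens.coe_finset_inf, Finset.inf_eq_iInf]
      simpa using hyM
    refine ⟨W, hWN, hyW, ?_⟩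
    · rw [resP_wedgeP]
      have h1 (i) : resP P hWN (x i) ∈
          Submodule.span Γ(X, W) (resP P (hWN.trans hN) '' S) := by
        have := resP_mem_span (hW i) (hxM i)
        rwa [resP_resP] at this
      refine Submodule.span_mono ?_ (wedgeP_mem_span h1)
      rintro _ ⟨a, ha, rfl⟩
      choose b hb hba using fun i ↦ ha ⟨i, rfl⟩
      refine ⟨_, ⟨b, ?_, rfl⟩, ?_⟩
      · rintro _ ⟨i, rfl⟩; exact hb i
      · rw [resP_wedgeP]
        simp only [hba]

/-! ### Duals -/

/-- On an integral affine open subset `Z`, a homomorphism `P ⟶ 𝒪` over the basic open subset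
`D(t)` extends to `Z` after multiplication with a high power of `t`, if `P` is finitely
generated over `Z`. -/
lemma exists_extends_pow_smul [IsReduced X] {P : PreMod X} {Z : X.Opens} (hZ : IsAffineOpen Z)
    [IsDomain Γ(X, Z)] {S : Set (P.obj (op Z))} (hfin : S.Finite) (hS : GeneratesLocally P S)
    {t : Γ(X, Z)} (ht : t ≠ 0) (φ : Γ(dual P, X.basicOpen t)) :
    ∃ a₀ : ℕ, ∀ a ≥ a₀, ∃ ψ : Γ(dual P, Z), res (dual P) (X.basicOpen_le t) ψ =
      resO (X.basicOpen_le t) t ^ a • φ := by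
  have hinj := injOn_structureSheaf_basicOpen hZ ht
  let D := X.basicOpen t
  have hD : D ≤ Z := X.basicOpen_le t
  let v (s : P.obj (op Z)) : Γ(X, D) :=
    homApp (P := P) (F := structureSheaf X) φ le_rfl (resP P hD s)
  have hpole (s : P.obj (op Z)) : ∃ a₀ : ℕ, ∀ a ≥ a₀, ∃ c : Γ(X, Z),
      resO hD c = resO hD t ^ a * v s := by
    obtain ⟨n, c, hc⟩ := exists_resO_eq_pow_mul hZ t (v s)
    refine ⟨n, fun a ha ↦ ⟨t ^ (a - n) * c, ?_⟩⟩
    obtain ⟨b, rfl⟩ := Nat.exists_eq_add_of_le ha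
    rw [Nat.add_sub_cancel_left, map_mul, map_pow, hc, pow_add]
    ring
  choose a₀ ha₀ using hpole
  obtain ⟨A, hA⟩ := (hfin.image a₀).bddAbove
  refine ⟨A, fun a ha ↦ ?_⟩
  have hval (s) (hs : s ∈ S) := ha₀ s a ((hA ⟨s, hs, rfl⟩).trans ha)
  obtain ⟨ψ, hψ⟩ := exists_hom_extension (P := P) hinj
    (homRestrict P (structureSheaf X) (inf_le_right : Z ⊓ D ≤ D) (resO hD t ^ a • φ)) (by
      intro N hN p
      refine extends_of_local (hinj.mono hN) _ fun y hy ↦ ?_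
      obtain ⟨M, hM, hyM, hp⟩ := hS N hN p y hy
      refine ⟨M, hM, hyM, ?_⟩
      have key : ∀ q ∈ Submodule.span Γ(X, M) (resP P (hM.trans hN) '' S),
          Extends (structureSheaf X) (V := D) (N := M) (homApp (P := P) (F := structureSheaf X)
            (homRestrict P (structureSheaf X) (inf_le_right : Z ⊓ D ≤ D) (resO hD t ^ a • φ))
            (inf_le_inf_right D (hM.trans hN)) (resP P (inf_le_left : M ⊓ D ≤ M) q)) := by
        intro q hq
        induction hq using Submodule.span_induction with
        | zero => rw [map_zero, map_zero]; exact .zero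
        | add _ _ _ _ h h' => rw [map_add, map_add]; exact h.add h'
        | smul r _ _ h => rw [map_smulₛₗ, map_smul]; exact h.smul r
        | mem q hq =>
          obtain ⟨s, hs, rfl⟩ := hq
          obtain ⟨c, hc⟩ := hval s hs
          refine ⟨resO (hM.trans hN) c, ?_⟩
          have h1 := congrArg (resO (inf_le_right : M ⊓ D ≤ D)) hc
          have h2 := resP_homApp (P := P) (F := structureSheaf X) φ le_rfl
            (inf_le_right : M ⊓ D ≤ D) (resP P hD s)
          change _ = resO (inf_le_right : M ⊓ D ≤ D) (v s) at h2
          change resO _ (resO _ c) = resO (inf_le_right : M ⊓ D ≤ D) (resO hD t ^ a) *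
            (show Γ(X, M ⊓ D) from homApp (P := P) (F := structureSheaf X) φ
              (inf_le_right : M ⊓ D ≤ D) (resP P inf_le_left (resP P (hM.trans hN) s)))
          simp only [resO_resO, resP_resP, map_mul] at h1 h2 ⊢
          rw [h1, ← h2]
      have := key _ hp
      rw [← resP_homApp]
      simpa only [resP_resP] using this)
  refine ⟨ψ, ?_⟩
  have hle : D ≤ Z ⊓ D := le_inf hD le_rfl
  have := congrArg (res (dual P) hle) hψ
  exact this

/-- The dual of a finitely generated presheaf of modules is finitely generated over an integral
affine open subset: it embeds into a free module by evaluation at the generators. -/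
lemma exists_generatesLocally_dual [IsLocallyNoetherian X] [IsReduced X] {P : PreMod X}
    {Z : X.Opens} (hZ : IsAffineOpen Z) [IsDomain Γ(X, Z)] {S : Set (P.obj (op Z))}
    (hfin : S.Finite) (hS : GeneratesLocally P S) :
    ∃ T : Set (Γ(dual P, Z)), T.Finite ∧ GeneratesLocally (dual P).val T := by
  have _ : IsNoetherianRing Γ(X, Z) := IsLocallyNoetherian.component_noetherian ⟨Z, hZ⟩
  have _ := hfin.to_subtype
  let ev : homSections P (structureSheaf X) Z →ₗ[Γ(X, Z)] (S → Γ(X, Z)) :=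
    { toFun := fun φ s ↦ homApp φ le_rfl s.1
      map_add' := fun _ _ ↦ rfl
      map_smul' := fun r φ ↦ by
        funext s
        change resO le_rfl r * _ = r * _
        rw [resO_self]
        rfl }
  have hev : Function.Injective ev := by
    rw [injective_iff_map_eq_zero]
    intro φ hφ
    refine homSections_ext (ψ := 0) fun N hN p ↦ section_ext _ fun y hy ↦ ?_
    obtain ⟨M, hM, hyM, hp⟩ := hS N hN p y hy
    refine ⟨M, hM, hyM, ?_⟩
    rw [← resP_homApp, homApp_zero, map_zero]
    generalize resP P hM p = q at hp ⊢
    induction hp using Submodule.span_induction with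
    | zero => rw [map_zero]
    | add _ _ _ _ h h' => rw [map_add, h, h', add_zero]
    | smul r _ _ h => rw [map_smul, h, smul_zero]
    | mem q hq =>
      obtain ⟨s, hs, rfl⟩ := hq
      have h1 := resP_homApp φ le_rfl (hM.trans hN) s
      have h2 : homApp φ le_rfl s = 0 := congrFun hφ ⟨s, hs⟩
      rw [h2, map_zero] at h1
      exact h1
  have hN : IsNoetherian Γ(X, Z) (homSections P (structureSheaf X) Z) :=
    isNoetherian_of_injective ev hev
  obtain ⟨T, hTfin, hT⟩ : ∃ T : Set Γ(dual P, Z), T.Finite ∧ Submodule.span Γ(X, Z) T = ⊤ :=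
    Submodule.fg_def.1 (hN.noetherian ⊤)
  refine ⟨T, hTfin, fun N hN q y hy ↦ ?_⟩
  obtain ⟨t, htN, hyt⟩ := hZ.exists_basicOpen_le ⟨y, hy⟩ (hN hy)
  have ht : t ≠ 0 := by
    rintro rfl
    rw [Scheme.basicOpen_zero] at hyt
    exact hyt
  obtain ⟨n, hn⟩ := exists_extends_pow_smul hZ hfin hS ht (res (dual P) htN q)
  obtain ⟨ψ, hψ⟩ := hn n le_rfl
  refine ⟨_, htN, hyt, ?_⟩
  have h1 : ψ ∈ Submodule.span Γ(X, Z) (resP (dual P).val le_rfl '' T) := by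
    rw [image_resP_self (dual P).val T]
    exact hT.ge (Submodule.mem_top (x := ψ))
  have h2 := resP_mem_span (X.basicOpen_le t) h1
  have h3 : resP (dual P).val (X.basicOpen_le t) ψ =
    resO (X.basicOpen_le t) t ^ n • resP (dual P).val htN q := hψ
  rw [h3] at h2
  obtain ⟨v, hv⟩ := (isUnit_resO t le_rfl).pow n
  rw [← hv] at h2
  exact (Submodule.smul_mem_iff_of_isUnit _ v.isUnit).1 h2

lemma IsFiniteType.dual [IsLocallyNoetherian X] [IsNormal X] {P : PreMod X}
    (hP : IsFiniteType P) : IsFiniteType (dual P).val := by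
  intro x
  obtain ⟨Z, hZ, _, hxZ, -, S, hfin, hS⟩ := hP.exists_isAffineOpen (Opens.mem_top x)
  exact ⟨Z, hxZ, exists_generatesLocally_dual hZ hfin hS⟩

lemma IsFiniteType.reflexiveHull [IsLocallyNoetherian X] [IsNormal X] {P : PreMod X}
    (hP : IsFiniteType P) : IsFiniteType (reflexiveHull P).val := hP.dual.dual

end

section

variable {X : Scheme.{u}}

/-! ### Differentials and quasi-coherent sheaves -/

section Differentials

variable {k : Type u} [Field k] (π : X ⟶ Spec (.of k))

/-- The universal derivation of sections over `N`. -/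
def dP (N : X.Opens) (b : Γ(X, N)) : (differentials π).obj (op N) :=
  CommRingCat.KaehlerDifferential.d (f := (structureMap π).app (op N)) b

lemma dP_mul {N : X.Opens} (a b : Γ(X, N)) : dP π N (a * b) = a • dP π N b + b • dP π N a :=
  ModuleCat.Derivation.d_mul _ a b

lemma resP_dP {N N' : X.Opens} (h : N' ≤ N) (b : Γ(X, N)) :
    resP (differentials π) h (dP π N b) = dP π N' (resO h b) :=
  PresheafOfModules.DifferentialsConstruction.relativeDifferentials'_map_d
    (structureMap π) (homOfLE h).op b

lemma span_range_dP (N : X.Opens) : Submodule.span Γ(X, N) (Set.range (dP π N)) = ⊤ :=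
  let : Algebra k Γ(X, N) := RingHom.toAlgebra (R := k) ((structureMap π).app (op N)).hom
  KaehlerDifferential.span_range_derivation k Γ(X, N)

lemma finiteType_structureMap [LocallyOfFiniteType π] {Z : X.Opens} (hZ : IsAffineOpen Z) :
    ((structureMap π).app (op Z)).hom.FiniteType := by
  have h1 : (π.appLE ⊤ Z le_top).hom.FiniteType := π.finiteType_appLE (isAffineOpen_top _) hZ _
  have h2 : (Scheme.ΓSpecIso (.of k)).inv.hom.FiniteType :=
    RingHom.FiniteType.of_surjective _
      (ConcreteCategory.bijective_of_isIso (Scheme.ΓSpecIso (.of k)).inv).surjective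
  exact h1.comp h2

lemma exists_generatesLocally_differentials [LocallyOfFiniteType π] {Z : X.Opens}
    (hZ : IsAffineOpen Z) :
    ∃ S : Set ((differentials π).obj (op Z)), S.Finite ∧ GeneratesLocally (differentials π) S := by
  have hfg : ∃ S : Set ((differentials π).obj (op Z)), S.Finite ∧
      Submodule.span Γ(X, Z) S = ⊤ := by
    let : Algebra k Γ(X, Z) := RingHom.toAlgebra (R := k) ((structureMap π).app (op Z)).hom
    have : Algebra.FiniteType k Γ(X, Z) := finiteType_structureMap π hZ
    have h : Module.Finite Γ(X, Z) (Ω[Γ(X, Z)⁄k]) := inferInstance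
    exact Submodule.fg_def.1 h.1
  obtain ⟨S, hfin, hS⟩ := hfg
  refine ⟨S, hfin, generatesLocally_of_span_eq_top hZ hS fun t q ↦ ?_⟩
  have hq : q ∈ Submodule.span Γ(X, X.basicOpen t) (Set.range (dP π (X.basicOpen t))) := by
    rw [span_range_dP]; trivial
  induction hq using Submodule.span_induction with
  | zero => exact ⟨0, 0, by rw [map_zero, smul_zero]⟩
  | add q q' _ _ h h' =>
    obtain ⟨n, m, h⟩ := h
    obtain ⟨n', m', h'⟩ := h'
    refine ⟨n + n', t ^ n' • m + t ^ n • m', ?_⟩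
    rw [map_add, map_smulₛₗ, map_smulₛₗ, h, h', map_pow, map_pow, smul_smul, smul_smul, smul_add,
      pow_add, mul_comm]
  | smul r q _ h =>
    obtain ⟨n, m, h⟩ := h
    obtain ⟨n', c, hc⟩ := exists_resO_eq_pow_mul hZ t r
    refine ⟨n + n', c • m, ?_⟩
    rw [map_smulₛₗ, h, hc, smul_smul, smul_smul]
    congr 1
    ring
  | mem q hq =>
    obtain ⟨b, rfl⟩ := hq
    obtain ⟨n, c, hc⟩ := exists_resO_eq_pow_mul hZ t b
    -- with `u = tⁿ` and `c = u b`, the Leibniz rule gives `u² db = u dc - c du`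
    refine ⟨n + n, t ^ n • dP π Z c - c • dP π Z (t ^ n), ?_⟩
    rw [map_sub, map_smulₛₗ, map_smulₛₗ, resP_dP, resP_dP, hc, map_pow, dP_mul, smul_add,
      smul_smul, smul_smul, pow_add]
    abel

lemma isFiniteType_differentials [LocallyOfFiniteType π] : IsFiniteType (differentials π) := by
  intro x
  obtain ⟨Z, hZ, hxZ, -⟩ := exists_isAffineOpen_mem_and_subset (Opens.mem_top x)
  exact ⟨Z, hxZ, exists_generatesLocally_differentials π hZ⟩

end Differentials

/-- Multiplication by `t` on the restriction of `F` to `Spec Γ(X, Z)`. -/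
lemma smul_restrict_fromSpec {Z : X.Opens} (hZ : IsAffineOpen Z) (F : X.Modules) (t : Γ(X, Z))
    (D : (Spec Γ(X, Z)).Opens) (h : hZ.fromSpec ''ᵁ D ≤ Z)
    (q : Γ(F.restrict hZ.fromSpec, D)) :
    (t • q : Γ(F.restrict hZ.fromSpec, D)) =
      (resO h t • (show Γ(F, hZ.fromSpec ''ᵁ D) from q) : Γ(F, hZ.fromSpec ''ᵁ D)) := by
  rw [Scheme.Modules.smul_Spec_def]
  have key : (hZ.fromSpec.appIso D).inv
      ((Spec Γ(X, Z)).presheaf.map D.leTop.op ((Scheme.ΓSpecIso Γ(X, Z)).inv t)) =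
      resO h t := by
    have h1 : (hZ.fromSpec.appIso D).hom (resO h t) =
      (Spec Γ(X, Z)).presheaf.map D.leTop.op ((Scheme.ΓSpecIso Γ(X, Z)).inv t) := by
      rw [Scheme.Hom.appIso_hom']
      have h0 : X.presheaf.map (homOfLE h).op ≫
          hZ.fromSpec.appLE (hZ.fromSpec ''ᵁ D) D (hZ.fromSpec.preimage_image_eq D).ge =
          (Scheme.ΓSpecIso Γ(X, Z)).inv ≫ (Spec Γ(X, Z)).presheaf.map D.leTop.op := by
        rw [Scheme.Hom.map_appLE, Scheme.Hom.appLE, hZ.fromSpec_app_self, Category.assoc,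
          ← Functor.map_comp]
        rfl
      exact ConcreteCategory.congr_hom h0 t
    rw [← h1]
    simp
  rw [← key]
  rfl

lemma generatesLocally_of_isQuasicoherent {F : X.Modules} [F.IsQuasicoherent] {Z : X.Opens}
    (hZ : IsAffineOpen Z) {S : Set Γ(F, Z)} (hS : Submodule.span Γ(X, Z) S = ⊤) :
    GeneratesLocally F.val S := by
  refine generatesLocally_of_span_eq_top (P := F.val) hZ hS fun t q ↦ ?_
  let M := F.restrict hZ.fromSpec
  have hM : M.IsQuasicoherent := inferInstance
  have hM' := (isIso_fromTildeΓ_iff_isLocalizing M).1 inferInstance t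
  let D : (Spec Γ(X, Z)).Opens := PrimeSpectrum.basicOpen t
  have hD : hZ.fromSpec ''ᵁ D = X.basicOpen t := hZ.fromSpec_image_basicOpen t
  have hT : hZ.fromSpec ''ᵁ ⊤ = Z := by simp
  let q' : Γ(F, X.basicOpen t) := q
  obtain ⟨⟨m, ⟨_, n, rfl⟩⟩, hm⟩ := hM'.surj (res F hD.le q')
  let m' : Γ(F, hZ.fromSpec ''ᵁ ⊤) := m
  refine ⟨n, res F hT.ge m', ?_⟩
  have h1 := smul_restrict_fromSpec hZ F (t ^ n) D (hD.le.trans (X.basicOpen_le t))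
    (res F hD.le q')
  have h2 : resO (hD.le.trans (X.basicOpen_le t)) (t ^ n) • res F hD.le q' =
    res F (hD.le.trans ((X.basicOpen_le t).trans hT.ge)) m' := h1.symm.trans hm
  have h3 := congrArg (res F hD.ge) h2
  rw [map_smulₛₗ, res_res, res_res, res_self, resO_resO, map_pow] at h3
  change res F _ (res F _ m') = _ • q'
  rw [res_res, ← h3]
  rfl

lemma IsDualizingModule.finite {A : Type u} [CommRing A] {M : ModuleCat.{u} A}
    (h : IsDualizingModule A M) : Module.Finite A M := by
  obtain ⟨I, n, hI, -, -, ⟨e⟩⟩ := h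
  have := hI.finite n
  exact Module.Finite.equiv e.toLinearEquiv.symm

lemma IsDualizingSheaf.isFiniteType [IsLocallyNoetherian X] [IsNormal X] {ω : X.Modules}
    (h : IsDualizingSheaf ω) : IsFiniteType ω.val := by
  have _ := h.isQuasicoherent
  refine isFiniteType_of_isAffineOpen fun Z hZ hd ↦ ?_
  have := (h.isDualizingModule ⟨Z, hZ⟩ hd).finite
  obtain ⟨S, hfin, hS⟩ := Submodule.fg_def.1 this.1
  exact ⟨S, hfin, generatesLocally_of_isQuasicoherent hZ hS⟩

end

section

variable {X Y : Scheme.{u}}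

/-! ### Comparison of sheaves over the isomorphism locus -/

/-- The map on sections `𝒪_X(N) → 𝒪_Y(f⁻¹ N)`. -/
def appO (f : Y ⟶ X) (N : X.Opens) : Γ(X, N) →+* Γ(Y, f ⁻¹ᵁ N) := (f.app N).hom

lemma appO_resO (f : Y ⟶ X) {N M : X.Opens} (h : M ≤ N) (r : Γ(X, N)) :
    appO f M (resO h r) = resO (f.preimage_mono h) (appO f N r) :=
  ConcreteCategory.congr_hom (f.naturality (homOfLE h).op) r

/-- An isomorphism of the presheaf of modules `Q` on `X` with the direct image of the presheaf of
modules `P` on `Y`, over an open subset `U` of `X` over which `f : Y ⟶ X` is an isomorphism. It is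
given by semilinear bijections on sections. -/
structure Comparison (f : Y ⟶ X) (U : X.Opens) (Q : PreMod X) (P : PreMod Y) where
  /-- The bijection on sections. -/
  app (N : X.Opens) (hN : N ≤ U) : Q.obj (op N) →ₛₗ[appO f N] P.obj (op (f ⁻¹ᵁ N))
  bijective (N : X.Opens) (hN : N ≤ U) : Function.Bijective (app N hN)
  naturality (N : X.Opens) (hN : N ≤ U) (M : X.Opens) (hM : M ≤ N) (q : Q.obj (op N)) :
    app M (hM.trans hN) (resP Q hM q) = resP P (f.preimage_mono hM) (app N hN q)

variable {f : Y ⟶ X} {U : X.Opens}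

lemma bijective_appO [h : IsIso (f ∣_ U)] {N : X.Opens} (hN : N ≤ U) :
    Function.Bijective (appO f N) := by
  obtain ⟨V, rfl⟩ : ∃ V : U.toScheme.Opens, U.ι ''ᵁ V = N :=
    ⟨U.ι ⁻¹ᵁ N, by rw [Scheme.Hom.image_preimage_eq_opensRange_inf]; simpa using hN⟩
  have h1 : IsIso ((f ∣_ U).app V) := inferInstance
  have h2 : IsIso (f.app (U.ι ''ᵁ V)) := by
    rw [morphismRestrict_app] at h1
    have h3 : IsIso (Y.presheaf.map (eqToHom (image_morphismRestrict_preimage f U V)).op) :=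
      inferInstance
    exact @IsIso.of_isIso_comp_right _ _ _ _ _ _ _ h3 h1
  exact ConcreteCategory.bijective_of_isIso (f.app (U.ι ''ᵁ V))

lemma exists_preimage_eq [h : IsIso (f ∣_ U)] {M : Y.Opens} (hM : M ≤ f ⁻¹ᵁ U) :
    ∃ N ≤ U, f ⁻¹ᵁ N = M := by
  refine ⟨U.ι ''ᵁ (inv (f ∣_ U) ⁻¹ᵁ ((f ⁻¹ᵁ U).ι ⁻¹ᵁ M)), U.ι_image_le _, ?_⟩
  rw [← image_morphismRestrict_preimage, ← Scheme.Hom.comp_preimage, IsIso.hom_inv_id,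
    Scheme.Hom.id_preimage, Scheme.Hom.image_preimage_eq_opensRange_inf]
  simpa using hM

lemma le_of_preimage_le [h : IsIso (f ∣_ U)] {N N' : X.Opens} (hN : N ≤ U)
    (hle : f ⁻¹ᵁ N ≤ f ⁻¹ᵁ N') : N ≤ N' := by
  intro x hx
  obtain ⟨y, hy⟩ := (f ∣_ U).surjective ⟨x, hN hx⟩
  have h1 : f y.1 = x := by rw [← morphismRestrict_base_coe, hy]
  have h2 : y.1 ∈ f ⁻¹ᵁ N := by change f y.1 ∈ N; rwa [h1]
  have h3 : f y.1 ∈ N' := hle h2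
  rwa [h1] at h3

section Semilinear

variable {R S M N M' N' : Type*} [CommRing R] [CommRing S] [AddCommGroup M] [AddCommGroup N]
  [AddCommGroup M'] [AddCommGroup N'] [Module R M] [Module R N] [Module S M'] [Module S N']

/-- The inverse of a bijective semilinear map. -/
def invSemilinear (e : R ≃+* S) (g : M →ₛₗ[e.toRingHom] M') (hg : Function.Bijective g) :
    M' →ₛₗ[e.symm.toRingHom] M where
  toFun := (Equiv.ofBijective g hg).symm
  map_add' x y := by
    obtain ⟨x, rfl⟩ := hg.2 x
    obtain ⟨y, rfl⟩ := hg.2 y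
    rw [← map_add]
    simp only [Equiv.ofBijective_symm_apply_apply]
  map_smul' r x := by
    obtain ⟨x, rfl⟩ := hg.2 x
    obtain ⟨r, rfl⟩ := e.surjective r
    have : e r • g x = g (r • x) := (map_smulₛₗ g r x).symm
    rw [this, Equiv.ofBijective_symm_apply_apply, Equiv.ofBijective_symm_apply_apply]
    congr 1
    exact (e.symm_apply_apply r).symm

lemma invSemilinear_apply (e : R ≃+* S) (g : M →ₛₗ[e.toRingHom] M') (hg : Function.Bijective g)
    (x : M) : invSemilinear e g hg (g x) = x :=
  (Equiv.ofBijective g hg).symm_apply_apply x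

lemma apply_invSemilinear (e : R ≃+* S) (g : M →ₛₗ[e.toRingHom] M') (hg : Function.Bijective g)
    (x : M') : g (invSemilinear e g hg x) = x :=
  (Equiv.ofBijective g hg).apply_symm_apply x

lemma bijective_tensorProduct_map {σ : R →+* S} (hσ : Function.Bijective σ) {g : M →ₛₗ[σ] M'}
    {h : N →ₛₗ[σ] N'} (hg : Function.Bijective g) (hh : Function.Bijective h) :
    Function.Bijective (TensorProduct.map g h) := by
  obtain ⟨e, rfl⟩ : ∃ e : R ≃+* S, e.toRingHom = σ := ⟨.ofBijective σ hσ, rfl⟩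
  refine Function.bijective_iff_has_inverse.2
    ⟨TensorProduct.map (invSemilinear e g hg) (invSemilinear e h hh), fun x ↦ ?_, fun x ↦ ?_⟩
  · induction x using TensorProduct.induction_on with
    | zero => rw [map_zero, map_zero]
    | tmul a b => rw [TensorProduct.map_tmul, TensorProduct.map_tmul, invSemilinear_apply,
        invSemilinear_apply]
    | add x y hx hy => rw [map_add, map_add, hx, hy]
  · induction x using TensorProduct.induction_on with
    | zero => rw [map_zero, map_zero]
    | tmul a b => rw [TensorProduct.map_tmul, TensorProduct.map_tmul, apply_invSemilinear,
        apply_invSemilinear]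
    | add x y hx hy => rw [map_add, map_add, hx, hy]

end Semilinear

lemma bijective_exteriorMap {R S M N : Type u} [CommRing R] [CommRing S] [AddCommGroup M]
    [AddCommGroup N] [Module R M] [Module S N] {σ : R →+* S} (hσ : Function.Bijective σ)
    {g : M →ₛₗ[σ] N} (hg : Function.Bijective g) (n : ℕ) :
    Function.Bijective (exteriorMap g n) := by
  obtain ⟨e, rfl⟩ : ∃ e : R ≃+* S, e.toRingHom = σ := ⟨.ofBijective σ hσ, rfl⟩
  refine Function.bijective_iff_has_inverse.2
    ⟨exteriorMap (invSemilinear e g hg) n, fun x ↦ ?_, fun x ↦ ?_⟩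
  · exact (exteriorMap_of_comp (f'' := RingHom.id R) (by ext; simp) g (invSemilinear e g hg)
      LinearMap.id (fun m ↦ (invSemilinear_apply e g hg m).symm) n x).symm.trans
      (exteriorMap_of_id rfl _ (fun _ ↦ rfl) n x)
  · exact (exteriorMap_of_comp (f'' := RingHom.id S) (by ext; simp) (invSemilinear e g hg) g
      LinearMap.id (fun m ↦ (apply_invSemilinear e g hg m).symm) n x).symm.trans
      (exteriorMap_of_id rfl _ (fun _ ↦ rfl) n x)

namespace Comparison

/-- The comparison of the structure sheaves. -/
def unit (f : Y ⟶ X) (U : X.Opens) [IsIso (f ∣_ U)] :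
    Comparison f U (structureSheaf X).val (structureSheaf Y).val where
  app N _ :=
    { toFun := appO f N
      map_add' := map_add _
      map_smul' := map_mul (appO f N) }
  bijective _ hN := bijective_appO hN
  naturality _ _ _ hM q := appO_resO f hM q

variable {Q Q' : PreMod X} {P P' : PreMod Y}

section

open MonoidalCategory

/-- The comparison map of tensor products. -/
def tensorApp (c : Comparison f U Q P) (c' : Comparison f U Q' P') (N : X.Opens) (hN : N ≤ U) :
    (Q ⊗ Q' : PreMod X).obj (op N) →ₛₗ[appO f N] (P ⊗ P' : PreMod Y).obj (op (f ⁻¹ᵁ N)) :=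
  TensorProduct.map (c.app N hN) (c'.app N hN)

lemma tensorApp_tmulP (c : Comparison f U Q P) (c' : Comparison f U Q' P') (N : X.Opens)
    (hN : N ≤ U) (p : Q.obj (op N)) (q : Q'.obj (op N)) :
    tensorApp c c' N hN (tmulP Q Q' N p q) = tmulP P P' _ (c.app N hN p) (c'.app N hN q) :=
  TensorProduct.map_tmul (c.app N hN) (c'.app N hN) p q

/-- The comparison of tensor products. -/
def tensor [IsIso (f ∣_ U)] (c : Comparison f U Q P) (c' : Comparison f U Q' P') :
    Comparison f U (Q ⊗ Q' : PreMod X) (P ⊗ P' : PreMod Y) where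
  app N hN := tensorApp c c' N hN
  bijective N hN := bijective_tensorProduct_map (bijective_appO hN) (c.bijective N hN)
    (c'.bijective N hN)
  naturality N hN M hM q := by
    induction q using tensor_induction with
    | zero => simp only [map_zero]
    | add x y hx hy => simp only [map_add, hx, hy]
    | tmul p q =>
      rw [resP_tmulP, tensorApp_tmulP, tensorApp_tmulP, resP_tmulP, c.naturality N hN,
        c'.naturality N hN]

end

/-- The comparison of tensor powers. -/
def tensorPower [IsIso (f ∣_ U)] (c : Comparison f U Q P) :
    ∀ m : ℕ, Comparison f U (tensorPower Q m) (tensorPower P m)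
  | 0 => unit f U
  | m + 1 => (c.tensorPower m).tensor c

/-- The comparison map of exterior powers. -/
def wedgeApp (c : Comparison f U Q P) (n : ℕ) (N : X.Opens) (hN : N ≤ U) :
    (exteriorPowerPresheaf Q n).obj (op N) →ₛₗ[appO f N]
      (exteriorPowerPresheaf P n).obj (op (f ⁻¹ᵁ N)) :=
  exteriorMap (c.app N hN) n

lemma wedgeApp_wedgeP (c : Comparison f U Q P) (n : ℕ) (N : X.Opens) (hN : N ≤ U)
    (x : Fin n → Q.obj (op N)) :
    wedgeApp c n N hN (wedgeP Q n N x) = wedgeP P n _ (fun i ↦ c.app N hN (x i)) :=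
  exteriorMap_ιMulti (c.app N hN) n x

/-- The comparison of exterior powers. -/
def exteriorPower [IsIso (f ∣_ U)] (c : Comparison f U Q P) (n : ℕ) :
    Comparison f U (exteriorPowerPresheaf Q n) (exteriorPowerPresheaf P n) where
  app N hN := wedgeApp c n N hN
  bijective N hN := bijective_exteriorMap (bijective_appO hN) (c.bijective N hN) n
  naturality N hN M hM q := by
    have hq : q ∈ Submodule.span Γ(X, N) (Set.range (wedgeP Q n N)) := by
      have : Submodule.span Γ(X, N) (Set.range (wedgeP Q n N)) = ⊤ :=
        exteriorPower.ιMulti_span Γ(X, N) n (Q.obj (op N))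
      rw [this]; trivial
    induction hq using Submodule.span_induction with
    | zero => simp only [map_zero]
    | add x y _ _ hx hy => simp only [map_add, hx, hy]
    | smul r x _ hx => simp only [map_smulₛₗ, hx, appO_resO]
    | mem x hx =>
      obtain ⟨x, rfl⟩ := hx
      rw [resP_wedgeP, wedgeApp_wedgeP, wedgeApp_wedgeP, resP_wedgeP]
      simp only [c.naturality N hN M hM]

end Comparison

end

section

variable {X Y : Scheme.{u}} {f : Y ⟶ X} {U : X.Opens}

/-! ### Comparison of sheaves of homomorphisms -/

namespace Comparison

variable {Q : PreMod X} {P : PreMod Y} {F : X.Modules} {G : Y.Modules}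

/-- Homomorphisms on the source are determined by their values on sections coming from the
target. -/
lemma hom_ext [IsIso (f ∣_ U)] (c : Comparison f U Q P) {N : X.Opens} (hN : N ≤ U)
    {φ ψ : homSections P G (f ⁻¹ᵁ N)}
    (h : ∀ (N' : X.Opens) (hN' : N' ≤ N) (q : Q.obj (op N')),
      homApp φ (f.preimage_mono hN') (c.app N' (hN'.trans hN) q) =
        homApp ψ (f.preimage_mono hN') (c.app N' (hN'.trans hN) q)) : φ = ψ := by
  refine homSections_ext fun M hM p ↦ ?_
  obtain ⟨N', hN', rfl⟩ := exists_preimage_eq (hM.trans (f.preimage_mono hN))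
  obtain ⟨q, rfl⟩ := (c.bijective N' hN').2 p
  exact h N' (le_of_preimage_le hN' hM) q

/-- The comparison map on sections of sheaves of modules. -/
def sec (d : Comparison f U F.val G.val) (N : X.Opens) (hN : N ≤ U) :
    Γ(F, N) →ₛₗ[appO f N] Γ(G, f ⁻¹ᵁ N) := d.app N hN

lemma bijective_sec (d : Comparison f U F.val G.val) (N : X.Opens) (hN : N ≤ U) :
    Function.Bijective (d.sec N hN) := d.bijective N hN

lemma res_sec (d : Comparison f U F.val G.val) (N : X.Opens) (hN : N ≤ U) (M : X.Opens)
    (hM : M ≤ N) (q : Γ(F, N)) :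
    d.sec M (hM.trans hN) (res F hM q) = res G (f.preimage_mono hM) (d.sec N hN q) :=
  d.naturality N hN M hM q

/-- Transport of a homomorphism `φ : Q|_N ⟶ F|_N` to the source. -/
lemma exists_transport [IsIso (f ∣_ U)] (c : Comparison f U Q P) (d : Comparison f U F.val G.val)
    {N : X.Opens} (hN : N ≤ U) (φ : homSections Q F N) :
    ∃ ψ : homSections P G (f ⁻¹ᵁ N), ∀ (N' : X.Opens) (hN' : N' ≤ N) (q : Q.obj (op N')),
      homApp ψ (f.preimage_mono hN') (c.app N' (hN'.trans hN) q) =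
        d.sec N' (hN'.trans hN) (homApp φ hN' q) := by
  -- An open subset `M` of `f⁻¹ N` is `f⁻¹ N'` for a unique `N'`; quantifying over all `N'` with
  -- this property avoids transports along equalities of open subsets.
  have key : ∀ (M : Y.Opens), M ≤ f ⁻¹ᵁ N → ∀ (p : P.obj (op M)), ∃ s : Γ(G, M),
      ∀ (N' : X.Opens) (hN' : N' ≤ N) (h : f ⁻¹ᵁ N' = M) (q : Q.obj (op N')),
        p = resP P h.ge (c.app N' (hN'.trans hN) q) →
        s = res G h.ge (d.sec N' (hN'.trans hN) (homApp φ hN' q)) := by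
    intro M hM p
    obtain ⟨N', hN', rfl⟩ := exists_preimage_eq (hM.trans (f.preimage_mono hN))
    obtain ⟨q, rfl⟩ := (c.bijective N' hN').2 p
    have hN'N : N' ≤ N := le_of_preimage_le hN' hM
    refine ⟨d.sec N' hN' (homApp φ hN'N q), fun N'' hN'' h q' hq ↦ ?_⟩
    obtain rfl : N'' = N' := le_antisymm (le_of_preimage_le (hN''.trans hN) h.le)
      (le_of_preimage_le hN' h.ge)
    rw [resP_self] at hq
    obtain rfl := (c.bijective N'' hN').1 hq
    rw [res_self]
  choose g hg using key
  have hg' : ∀ (N' : X.Opens) (hN' : N' ≤ N) (q : Q.obj (op N')),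
      g _ (f.preimage_mono hN') (c.app N' (hN'.trans hN) q) =
        d.sec N' (hN'.trans hN) (homApp φ hN' q) := fun N' hN' q ↦ by
    rw [hg _ (f.preimage_mono hN') _ N' hN' rfl q (resP_self P _).symm, res_self]
  refine ⟨mkHom g ?_ ?_ ?_, hg'⟩
  · intro M hM p p'
    obtain ⟨N', hN', rfl⟩ := exists_preimage_eq (hM.trans (f.preimage_mono hN))
    obtain ⟨q, rfl⟩ := (c.bijective N' hN').2 p
    obtain ⟨q', rfl⟩ := (c.bijective N' hN').2 p'
    have hN'N : N' ≤ N := le_of_preimage_le hN' hM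
    rw [hg' N' hN'N, hg' N' hN'N, ← map_add, hg' N' hN'N, map_add, map_add]
  · intro M hM r p
    obtain ⟨N', hN', rfl⟩ := exists_preimage_eq (hM.trans (f.preimage_mono hN))
    obtain ⟨q, rfl⟩ := (c.bijective N' hN').2 p
    obtain ⟨r, rfl⟩ := (bijective_appO hN').2 r
    have hN'N : N' ≤ N := le_of_preimage_le hN' hM
    rw [hg' N' hN'N, ← map_smulₛₗ, hg' N' hN'N, map_smul, map_smulₛₗ]
  · intro M hM M' hM' p
    obtain ⟨N', hN', rfl⟩ := exists_preimage_eq (hM.trans (f.preimage_mono hN))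
    obtain ⟨N'', hN'', rfl⟩ := exists_preimage_eq ((hM'.trans hM).trans (f.preimage_mono hN))
    obtain ⟨q, rfl⟩ := (c.bijective N' hN').2 p
    have hN'N : N' ≤ N := le_of_preimage_le hN' hM
    have hN''N' : N'' ≤ N' := le_of_preimage_le hN'' hM'
    rw [hg' N' hN'N, ← c.naturality N' hN' N'' hN''N', hg' N'' (hN''N'.trans hN'N), resP_homApp]
    exact d.res_sec N' hN' N'' hN''N' _

/-- The comparison map of sheaves of homomorphisms. -/
def homMap [IsIso (f ∣_ U)] (c : Comparison f U Q P) (d : Comparison f U F.val G.val)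
    (N : X.Opens) (hN : N ≤ U) : homSections Q F N →ₛₗ[appO f N] homSections P G (f ⁻¹ᵁ N) where
  toFun φ := (exists_transport c d hN φ).choose
  map_add' φ ψ := c.hom_ext hN fun N' hN' q ↦ by
    rw [homApp_add _ _ (f.preimage_mono hN'), (exists_transport c d hN φ).choose_spec N' hN',
      (exists_transport c d hN ψ).choose_spec N' hN', (exists_transport c d hN _).choose_spec N' hN',
      homApp_add _ _ hN', map_add]
  map_smul' r φ := c.hom_ext hN fun N' hN' q ↦ by
    rw [homApp_smul _ _ (f.preimage_mono hN'), (exists_transport c d hN φ).choose_spec N' hN',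
      (exists_transport c d hN _).choose_spec N' hN', homApp_smul _ _ hN', map_smulₛₗ, appO_resO]

lemma homApp_homMap [IsIso (f ∣_ U)] (c : Comparison f U Q P) (d : Comparison f U F.val G.val)
    {N : X.Opens} (hN : N ≤ U) (φ : homSections Q F N) {N' : X.Opens} (hN' : N' ≤ N)
    (q : Q.obj (op N')) :
    homApp (homMap c d N hN φ) (f.preimage_mono hN') (c.app N' (hN'.trans hN) q) =
      d.sec N' (hN'.trans hN) (homApp φ hN' q) :=
  (exists_transport c d hN φ).choose_spec N' hN' q

lemma bijective_homMap [IsIso (f ∣_ U)] (c : Comparison f U Q P) (d : Comparison f U F.val G.val)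
    {N : X.Opens} (hN : N ≤ U) : Function.Bijective (homMap c d N hN) := by
  refine ⟨fun φ ψ h ↦ homSections_ext fun N' hN' q ↦ (d.bijective_sec N' (hN'.trans hN)).1 ?_,
    fun ψ ↦ ?_⟩
  · rw [← homApp_homMap c d hN, ← homApp_homMap c d hN, h]
  · have key : ∀ (N' : X.Opens) (hN' : N' ≤ N) (q : Q.obj (op N')), ∃ s : Γ(F, N'),
        d.sec N' (hN'.trans hN) s =
          homApp ψ (f.preimage_mono hN') (c.app N' (hN'.trans hN) q) := fun N' hN' q ↦
      (d.bijective_sec N' (hN'.trans hN)).2 _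
    choose g hg using key
    let φ : homSections Q F N := mkHom g
      (fun N' hN' p q ↦ (d.bijective_sec N' (hN'.trans hN)).1 (by
        rw [hg, map_add, map_add, map_add, hg, hg]))
      (fun N' hN' r q ↦ (d.bijective_sec N' (hN'.trans hN)).1 (by
        rw [hg, map_smulₛₗ, map_smul, ← hg]
        exact (map_smulₛₗ (d.sec N' (hN'.trans hN)) r _).symm))
      (fun N' hN' N'' hN'' q ↦ (d.bijective_sec N'' (hN''.trans (hN'.trans hN))).1 (by
        rw [hg, c.naturality N' (hN'.trans hN), resP_homApp _ (f.preimage_mono hN'), ← hg]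
        exact (d.res_sec N' (hN'.trans hN) N'' hN'' _).symm))
    exact ⟨φ, c.hom_ext hN fun N' hN' q ↦ (homApp_homMap c d hN φ hN' q).trans (hg N' hN' q)⟩

/-- The comparison of sheaves of homomorphisms. -/
def sheafHom [IsIso (f ∣_ U)] (c : Comparison f U Q P) (d : Comparison f U F.val G.val) :
    Comparison f U (sheafHom Q F).val (sheafHom P G).val where
  app N hN := homMap c d N hN
  bijective N hN := bijective_homMap c d hN
  naturality N hN M hM φ := by
    refine c.hom_ext (hM.trans hN) fun N' hN' q ↦ ?_
    exact (homApp_homMap c d (hM.trans hN) _ hN' q).trans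
      (homApp_homMap c d hN φ (hN'.trans hM) q).symm

/-- The comparison of duals. -/
def dual [IsIso (f ∣_ U)] (c : Comparison f U Q P) : Comparison f U (dual Q).val (dual P).val :=
  c.sheafHom (F := structureSheaf X) (G := structureSheaf Y) (Comparison.unit f U)

/-- The comparison of reflexive hulls. -/
def reflexiveHull [IsIso (f ∣_ U)] (c : Comparison f U Q P) :
    Comparison f U (reflexiveHull Q).val (reflexiveHull P).val :=
  c.dual.dual

end Comparison

end

section

variable {X Y : Scheme.{u}} {f : Y ⟶ X} {U : X.Opens}

/-! ### Comparison of differentials and of restrictions -/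

lemma bijective_res (F : X.Modules) {N M : X.Opens} (h : M ≤ N) (h' : N ≤ M) :
    Function.Bijective (res F h) :=
  Function.bijective_iff_has_inverse.2 ⟨res F h', fun s ↦ by rw [res_res, res_self],
    fun s ↦ by rw [res_res, res_self]⟩

namespace Comparison

section Differentials

variable {k : Type u} [Field k] (π : X ⟶ Spec (.of k))

lemma structureMap_app_app (f : Y ⟶ X) (N : X.Opens) :
    (structureMap π).app (op N) ≫ f.app N = (structureMap (f ≫ π)).app (op (f ⁻¹ᵁ N)) := by
  have h := f.naturality (homOfLE (le_top : N ≤ ⊤)).op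
  simp only [structureMap, Category.assoc, Scheme.Hom.comp_appTop]
  congr 2

/-- The pullback of differentials along `f`. -/
def diffMap (f : Y ⟶ X) (N : X.Opens) : (differentials π).obj (op N) →ₛₗ[appO f N]
    (differentials (f ≫ π)).obj (op (f ⁻¹ᵁ N)) where
  toFun := (CommRingCat.KaehlerDifferential.map (f := (structureMap π).app (op N))
    (f' := (structureMap (f ≫ π)).app (op (f ⁻¹ᵁ N))) (g := 𝟙 _) (g' := f.app N)
    (by rw [structureMap_app_app, Category.id_comp])).hom
  map_add' := map_add _
  map_smul' r x := (CommRingCat.KaehlerDifferential.map (f := (structureMap π).app (op N))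
    (f' := (structureMap (f ≫ π)).app (op (f ⁻¹ᵁ N))) (g := 𝟙 _) (g' := f.app N)
    (by rw [structureMap_app_app, Category.id_comp])).hom.map_smul r x

lemma diffMap_dP (f : Y ⟶ X) (N : X.Opens) (b : Γ(X, N)) :
    diffMap π f N (dP π N b) = dP (f ≫ π) (f ⁻¹ᵁ N) (appO f N b) :=
  CommRingCat.KaehlerDifferential.map_d (f := (structureMap π).app (op N))
    (f' := (structureMap (f ≫ π)).app (op (f ⁻¹ᵁ N))) (g := 𝟙 _) (g' := f.app N)
    (by rw [structureMap_app_app, Category.id_comp]) b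

lemma bijective_diffMap [IsIso (f ∣_ U)] {N : X.Opens} (hN : N ≤ U) :
    Function.Bijective (diffMap π f N) := by
  let e : Γ(X, N) ≃+* Γ(Y, f ⁻¹ᵁ N) := RingEquiv.ofBijective (appO f N) (bijective_appO hN)
  have he (b : Γ(X, N)) : e.symm (appO f N b) = b := e.symm_apply_apply b
  have fac : 𝟙 _ ≫ (structureMap π).app (op N) = (structureMap (f ≫ π)).app (op (f ⁻¹ᵁ N)) ≫
      CommRingCat.ofHom e.symm.toRingHom := by
    rw [← structureMap_app_app, Category.id_comp]
    ext b
    exact (he _).symm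
  let ψ := CommRingCat.KaehlerDifferential.map fac
  let g : (differentials (f ≫ π)).obj (op (f ⁻¹ᵁ N)) →ₛₗ[e.symm.toRingHom]
      (differentials π).obj (op N) :=
    { toFun := ψ.hom
      map_add' := map_add _
      map_smul' := ψ.hom.map_smul }
  have hg (b : Γ(Y, f ⁻¹ᵁ N)) : g (dP (f ≫ π) _ b) = dP π N (e.symm b) :=
    CommRingCat.KaehlerDifferential.map_d fac b
  refine Function.bijective_iff_has_inverse.2 ⟨g, fun q ↦ ?_, fun q ↦ ?_⟩
  · have hq : q ∈ Submodule.span Γ(X, N) (Set.range (dP π N)) := by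
      rw [span_range_dP]; trivial
    induction hq using Submodule.span_induction with
    | zero => simp only [map_zero]
    | add x y _ _ hx hy => simp only [map_add, hx, hy]
    | smul r x _ hx => 
      rw [map_smulₛₗ, map_smulₛₗ, hx]
      congr 1
      exact he r
    | mem x hx =>
      obtain ⟨b, rfl⟩ := hx
      rw [diffMap_dP, hg, he]
  · have hq : q ∈ Submodule.span Γ(Y, f ⁻¹ᵁ N) (Set.range (dP (f ≫ π) (f ⁻¹ᵁ N))) := by
      rw [span_range_dP]; trivial
    induction hq using Submodule.span_induction with
    | zero => simp only [map_zero]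
    | add x y _ _ hx hy => simp only [map_add, hx, hy]
    | smul r x _ hx => 
      rw [map_smulₛₗ, map_smulₛₗ, hx]
      congr 1
      exact e.apply_symm_apply r
    | mem x hx =>
      obtain ⟨b, rfl⟩ := hx
      rw [hg, diffMap_dP]
      congr 1
      exact e.apply_symm_apply b

/-- The comparison of differentials. -/
def differentials (f : Y ⟶ X) (U : X.Opens) [IsIso (f ∣_ U)] :
    Comparison f U (differentials π) (differentials (f ≫ π)) where
  app N _ := diffMap π f N
  bijective _ hN := bijective_diffMap π hN
  naturality N hN M hM q := by
    have hq : q ∈ Submodule.span Γ(X, N) (Set.range (dP π N)) := by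
      rw [span_range_dP]; trivial
    induction hq using Submodule.span_induction with
    | zero => simp only [map_zero]
    | add x y _ _ hx hy => simp only [map_add, hx, hy]
    | smul r x _ hx => simp only [map_smulₛₗ, hx, appO_resO]
    | mem x hx =>
      obtain ⟨b, rfl⟩ := hx
      rw [resP_dP, diffMap_dP, diffMap_dP, resP_dP, appO_resO]

/-- The comparison of canonical sheaves. -/
def canonicalSheaf (f : Y ⟶ X) (U : X.Opens) [IsIso (f ∣_ U)] (n : ℕ) :
    Comparison f U (canonicalSheaf π n).val (canonicalSheaf (f ≫ π) n).val :=
  ((differentials π f U).exteriorPower n).reflexiveHull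

end Differentials

section Restrict

variable {F : X.Modules} {G : Y.Modules}

lemma ι_image_preimage {N : X.Opens} (hN : N ≤ U) : U.ι ''ᵁ (U.ι ⁻¹ᵁ N) = N := by
  rw [Scheme.Hom.image_preimage_eq_opensRange_inf]; simpa using hN

/-- The map on sections over `W ⊆ U` induced by a morphism of restrictions to `U`. -/
def restrictMap (e : F.restrict U.ι ⟶ ((Scheme.Modules.pushforward f).obj G).restrict U.ι)
    (W : U.toScheme.Opens) :
    Γ(F, U.ι ''ᵁ W) →ₛₗ[appO f (U.ι ''ᵁ W)] Γ(G, f ⁻¹ᵁ (U.ι ''ᵁ W)) where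
  toFun := e.app W
  map_add' := map_add _
  map_smul' r s := by
    -- the scalar action on a restriction is twisted by `U.ι.appIso W`, which is the identity
    have h1 : (U.ι.appIso W).inv = 𝟙 _ := by rw [Scheme.Opens.ι_appIso]; rfl
    have h2 (t : Γ(X, U.ι ''ᵁ W)) : (U.ι.appIso W).inv t = t := by rw [h1]; rfl
    have h : e.app W ((U.ι.appIso W).inv r • s : Γ(F, U.ι ''ᵁ W)) =
      (appO f (U.ι ''ᵁ W) ((U.ι.appIso W).inv r) • (show Γ(G, f ⁻¹ᵁ (U.ι ''ᵁ W)) from e.app W s) :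
        Γ(G, f ⁻¹ᵁ (U.ι ''ᵁ W))) := e.app_smul (U := W) r s
    rwa [h2] at h

lemma res_restrictMap (e : F.restrict U.ι ⟶ ((Scheme.Modules.pushforward f).obj G).restrict U.ι)
    {W W' : U.toScheme.Opens} (h : W' ≤ W) (s : Γ(F, U.ι ''ᵁ W)) :
    restrictMap e W' (res F (U.ι.image_mono h) s) =
      res G (f.preimage_mono (U.ι.image_mono h)) (restrictMap e W s) :=
  ConcreteCategory.congr_hom (e.mapPresheaf.naturality (homOfLE h).op) s

lemma bijective_restrictMap
    (e : F.restrict U.ι ≅ ((Scheme.Modules.pushforward f).obj G).restrict U.ι)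
    (W : U.toScheme.Opens) : Function.Bijective (restrictMap e.hom W) :=
  ConcreteCategory.bijective_of_isIso (e.hom.app W)

/-- The comparison given by an isomorphism of restrictions to `U`. -/
def ofIso (e : F.restrict U.ι ≅ ((Scheme.Modules.pushforward f).obj G).restrict U.ι) :
    Comparison f U F.val G.val where
  app N hN :=
    { toFun := fun s ↦ res G (f.preimage_mono (ι_image_preimage hN).ge)
        (restrictMap e.hom (U.ι ⁻¹ᵁ N) (res F (ι_image_preimage hN).le s))
      map_add' := fun s t ↦ by
        let s' : Γ(F, N) := s
        let t' : Γ(F, N) := t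
        change res G _ (restrictMap e.hom _ (res F _ (s' + t'))) = _
        rw [map_add, map_add, map_add]
        rfl
      map_smul' := fun r s ↦ by
        let s' : Γ(F, N) := s
        change res G _ (restrictMap e.hom _ (res F _ (r • s'))) = _
        rw [map_smulₛₗ, map_smulₛₗ, map_smulₛₗ, appO_resO, resO_resO, resO_self]
        rfl }
  bijective _ hN := by
    refine (bijective_res G _ ?_).comp ((bijective_restrictMap e _).comp (bijective_res F _ ?_))
    · exact f.preimage_mono (ι_image_preimage hN).le
    · exact (ι_image_preimage hN).ge
  naturality N hN M hM s := by
    let s' : Γ(F, N) := s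
    change res G _ (restrictMap e.hom _ (res F _ (res F hM s'))) =
      res G _ (res G _ (restrictMap e.hom _ (res F _ s')))
    have h := res_restrictMap e.hom (U.ι.preimage_mono hM) (res F (ι_image_preimage hN).le s')
    rw [res_res] at h
    rw [res_res, h, res_res, res_res]

end Restrict

end Comparison

end

section

variable {X Y : Scheme.{u}} {f : Y ⟶ X} {U : X.Opens}

/-! ### The isomorphism locus -/

lemma le_isoLocus (h : IsIso (f ∣_ U)) : U ≤ isoLocus f := le_sSup h

instance isIso_isoLocus (f : Y ⟶ X) : IsIso (f ∣_ isoLocus f) := by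
  change MorphismProperty.isomorphisms Scheme (f ∣_ isoLocus f)
  refine IsZariskiLocalAtTarget.of_forall_exists_morphismRestrict fun x ↦ ?_
  obtain ⟨U, hU, hxU⟩ := Opens.mem_sSup.1 x.2
  refine ⟨(isoLocus f).ι ⁻¹ᵁ U, hxU, ?_⟩
  have h : (isoLocus f).ι ''ᵁ ((isoLocus f).ι ⁻¹ᵁ U) = U :=
    Comparison.ι_image_preimage (le_isoLocus hU)
  exact ((MorphismProperty.isomorphisms Scheme).arrow_mk_iso_iff
    (morphismRestrictRestrict f _ _ ≪≫ morphismRestrictEq f h)).2 hU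

/-- A section of `f` over `N` is an isomorphism onto `f⁻¹ N` if `f` is separated, and bijective
over an open subset with dense preimage in the reduced scheme `Y`. -/
lemma isIso_of_section [IsReduced Y] [IsSeparated f] (hU : Dense (f ⁻¹ᵁ U : Set Y))
    (hinj : ∀ y ∈ f ⁻¹ᵁ U, ∀ y' ∈ f ⁻¹ᵁ U, f y = f y' → y = y') {N : X.Opens}
    (σ : N.toScheme ⟶ Y) (hσ : σ ≫ f = N.ι) : IsIso (f ∣_ N) := by
  have hr : Set.range σ ⊆ Set.range (f ⁻¹ᵁ N).ι := by
    rintro _ ⟨x, rfl⟩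
    rw [Scheme.Opens.range_ι]
    change f (σ x) ∈ N
    rw [← Scheme.Hom.comp_apply, hσ]
    exact x.2
  let τ : N.toScheme ⟶ (f ⁻¹ᵁ N).toScheme := IsOpenImmersion.lift (f ⁻¹ᵁ N).ι σ hr
  have hτ : τ ≫ (f ⁻¹ᵁ N).ι = σ := IsOpenImmersion.lift_fac _ _ _
  have hτ' : τ ≫ f ∣_ N = 𝟙 _ := by
    rw [← cancel_mono N.ι, Category.assoc, morphismRestrict_ι, ← Category.assoc, hτ, hσ,
      Category.id_comp]
  have : IsClosedImmersion (τ ≫ f ∣_ N) := by rw [hτ']; infer_instance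
  have : IsClosedImmersion τ := .of_comp τ (f ∣_ N)
  have hfac (x : N) : (τ x).1 = σ x := by rw [← hτ]; rfl
  have : Surjective τ := by
    refine ⟨fun y ↦ ?_⟩
    have hcl : IsClosed (Set.range τ) := τ.isClosedEmbedding.isClosed_range
    by_contra hy
    obtain ⟨W, hW, hWy⟩ := isOpen_induced_iff.1 hcl.isOpen_compl
    have hyW : y.1 ∈ W := by
      have : y ∈ (Subtype.val ⁻¹' W : Set (f ⁻¹ᵁ N : Y.Opens)) := hWy ▸ hy
      exact this
    obtain ⟨z, ⟨hzW, hzN⟩, hzU⟩ := hU.inter_open_nonempty (W ∩ (f ⁻¹ᵁ N : Y.Opens))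
      (hW.inter (f ⁻¹ᵁ N).2) ⟨y.1, hyW, y.2⟩
    have hz : (⟨z, hzN⟩ : (f ⁻¹ᵁ N : Y.Opens)) ∈ (Set.range τ)ᶜ := hWy ▸ hzW
    let x : N.toScheme := ⟨f z, hzN⟩
    refine hz ⟨x, Subtype.ext ?_⟩
    have h1 : f (σ x) = f z := by rw [← Scheme.Hom.comp_apply, hσ]; rfl
    rw [hfac]
    refine hinj _ ?_ z hzU h1
    change f (σ _) ∈ U
    rw [h1]; exact hzU
  have : IsIso τ := isIso_of_isClosedImmersion_of_surjective τ
  have : f ∣_ N = inv τ := by rw [← cancel_epi τ, hτ', IsIso.hom_inv_id]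
  rw [this]; infer_instance

lemma valuationRing_of_ringKrullDim_le_one {R : Type*} [CommRing R] [IsDomain R] [IsLocalRing R]
    [IsNoetherianRing R] [IsIntegrallyClosed R] (h : ringKrullDim R ≤ 1) : ValuationRing R := by
  have h1 : Ring.KrullDimLE 1 R := Ring.krullDimLE_iff.2 h
  refine ((tfae_of_isNoetherianRing_of_isLocalRing_of_isDomain R).out 3 1 rfl rfl).1
    ⟨inferInstance, fun P hP hP' ↦ IsLocalRing.eq_maximalIdeal ?_⟩
  exact Ring.krullDimLE_one_iff_of_isPrime_bot.1 h1 P hP hP'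

/-- The generic point of the local scheme at a point lies in every dense open subset. -/
lemma fromSpecStalk_bot_mem [IsLocallyNoetherian X] [IsNormal X] (hU : Dense (U : Set X)) (x : X) :
    X.fromSpecStalk x (⊥ : PrimeSpectrum (X.presheaf.stalk x)) ∈ U := by
  obtain ⟨Z, hZ, _, hxZ, -⟩ := exists_isAffineOpen_isDomain (Opens.mem_top x)
  obtain ⟨z, hzZ, hzU⟩ := hU.inter_open_nonempty Z Z.2 ⟨x, hxZ⟩
  let η := hZ.fromSpec (⊥ : PrimeSpectrum Γ(X, Z))
  have hη {w : X} (hw : w ∈ Z) : η ⤳ w := by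
    have : w ∈ Set.range hZ.fromSpec := by rw [hZ.range_fromSpec]; exact hw
    obtain ⟨p, rfl⟩ := this
    exact ((PrimeSpectrum.le_iff_specializes _ p).1 bot_le).map hZ.fromSpec.continuous
  have hηU : η ∈ U := (hη hzZ).mem_open U.2 hzU
  have : η ∈ Set.range (X.fromSpecStalk x) := by
    rw [Scheme.range_fromSpecStalk]; exact hη hxZ
  obtain ⟨p, hp⟩ := this
  rw [← hp] at hηU
  exact ((PrimeSpectrum.le_iff_specializes ⊥ p).1 bot_le).mem_open
    (X.fromSpecStalk x ⁻¹ᵁ U).2 hηU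

lemma exists_lift_of_valuationRing [UniversallyClosed f] {R K : Type u} [CommRing R] [IsDomain R]
    [ValuationRing R] [Field K] [Algebra R K] [IsFractionRing R K] (i : Spec (.of K) ⟶ Y)
    (j : Spec (.of R) ⟶ X) (h : i ≫ f = Spec.map (CommRingCat.ofHom (algebraMap R K)) ≫ j) :
    ∃ l : Spec (.of R) ⟶ Y, l ≫ f = j := by
  have hf : UniversallyClosed f := inferInstance
  rw [UniversallyClosed.eq_valuativeCriterion] at hf
  let S : ValuativeCommSq f := { R := R, K := K, i₁ := i, i₂ := j, commSq := ⟨h⟩ }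
  have := hf.1 S
  exact ⟨S.commSq.lift, S.commSq.fac_right⟩

/-- The isomorphism locus of a proper birational morphism to a normal scheme contains all points
of codimension at most one: by the valuative criterion `f` has a section over the local scheme at
such a point, which spreads out to a neighbourhood. -/
lemma mem_isoLocus_of_ringKrullDim_le_one [IsNoetherian X] [IsNormal X] [IsReduced Y]
    [IsProper f] (hf : IsBirational f) {x : X}
    (hx : ringKrullDim (X.presheaf.stalk x) ≤ 1) : x ∈ isoLocus f := by
  obtain ⟨U, hUX, hUY, hU⟩ := hf
  let K := FractionRing (X.presheaf.stalk x)
  have : ValuationRing (X.presheaf.stalk x) := valuationRing_of_ringKrullDim_le_one hx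
  let j : Spec (.of K) ⟶ X :=
    Spec.map (CommRingCat.ofHom (algebraMap (X.presheaf.stalk x) K)) ≫ X.fromSpecStalk x
  have hj : Set.range j ⊆ Set.range U.ι := by
    rintro _ ⟨p, rfl⟩
    rw [Scheme.Opens.range_ι]
    have hp : Spec.map (CommRingCat.ofHom (algebraMap (X.presheaf.stalk x) K)) p = (⊥ : PrimeSpectrum (X.presheaf.stalk x)) := by
      apply PrimeSpectrum.ext
      have h1 : (p : PrimeSpectrum K).asIdeal = ⊥ :=
        (Ideal.eq_bot_or_top _).resolve_right p.2.ne_top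
      change (p : PrimeSpectrum K).asIdeal.comap (algebraMap (X.presheaf.stalk x) K) = ⊥
      rw [h1]
      exact Ideal.comap_bot_of_injective _ (IsFractionRing.injective (X.presheaf.stalk x) K)
    change j p ∈ U
    rw [Scheme.Hom.comp_apply, hp]
    exact fromSpecStalk_bot_mem hUX x
  let i : Spec (.of K) ⟶ Y :=
    IsOpenImmersion.lift U.ι j hj ≫ inv (f ∣_ U) ≫ (f ⁻¹ᵁ U).ι
  have hi : i ≫ f = j := by
    simp only [i, Category.assoc]
    rw [← morphismRestrict_ι, IsIso.inv_hom_id_assoc, IsOpenImmersion.lift_fac]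
  obtain ⟨l, hl⟩ := @exists_lift_of_valuationRing X Y f _ (X.presheaf.stalk x) K
    (X.presheaf.stalk x).commRing (IsNormal.isDomain x) this _ _ _ i (X.fromSpecStalk x) hi
  obtain ⟨N, hxN, σ, -, hσ⟩ := spread_out_of_isGermInjective' (𝟙 X) f (x := x) l
    (hl.trans (Category.comp_id _).symm)
  rw [Category.comp_id] at hσ
  refine le_isoLocus (isIso_of_section hUY (fun y hy y' hy' h ↦ ?_) σ hσ) hxN
  let z : (f ⁻¹ᵁ U).toScheme := ⟨y, hy⟩
  let z' : (f ⁻¹ᵁ U).toScheme := ⟨y', hy'⟩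
  have h1 : (f ∣_ U) z = (f ∣_ U) z' :=
    Subtype.ext (by rw [morphismRestrict_base_coe, morphismRestrict_base_coe]; exact h)
  exact congrArg Subtype.val ((f ∣_ U).isOpenEmbedding.injective h1)

end

section

variable {X : Scheme.{u}}

/-! ### Twists by the powers of a Cartier divisor -/

/-- A section of the ideal presheaf, as a function. -/
def idealVal (I : X.IdealSheafData) (N : X.Opens) :
    (idealPresheaf I).obj (op N) →ₗ[Γ(X, N)] Γ(X, N) :=
  (idealSections I N).subtype

lemma idealVal_injective (I : X.IdealSheafData) (N : X.Opens) :
    Function.Injective (idealVal I N) := Subtype.val_injective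

lemma exists_idealVal_eq {I : X.IdealSheafData} {N : X.Opens} {r : Γ(X, N)}
    (hr : r ∈ idealSections I N) : ∃ q, idealVal I N q = r := ⟨⟨r, hr⟩, rfl⟩

lemma idealVal_mem {I : X.IdealSheafData} {N : X.Opens} (q : (idealPresheaf I).obj (op N)) :
    idealVal I N q ∈ idealSections I N := Subtype.property (p := (· ∈ idealSections I N)) q

lemma idealVal_resP (I : X.IdealSheafData) {N M : X.Opens} (h : M ≤ N)
    (q : (idealPresheaf I).obj (op N)) :
    idealVal I M (resP (idealPresheaf I) h q) = resO h (idealVal I N q) := rfl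

/-- The homomorphism `r ↦ r • s` on the ideal sheaf `I`. -/
def mulHom (I : X.IdealSheafData) {F : X.Modules} {N : X.Opens} (s : Γ(F, N)) :
    homSections (idealPresheaf I) F N :=
  mkHom (fun M hM q ↦ idealVal I M q • res F hM s)
    (fun M hM p q ↦ by rw [map_add, add_smul])
    (fun M hM r q ↦ by rw [map_smul, smul_eq_mul, mul_smul])
    (fun M hM M' hM' q ↦ by rw [idealVal_resP, map_smulₛₗ, res_res])

section mulHom

variable {I : X.IdealSheafData} {F : X.Modules} {N : X.Opens}

lemma homApp_mulHom (s : Γ(F, N)) {M : X.Opens} (hM : M ≤ N) (q : (idealPresheaf I).obj (op M)) :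
    homApp (mulHom I s) hM q = idealVal I M q • res F hM s := rfl

lemma mulHom_add (s t : Γ(F, N)) : mulHom I (s + t) = mulHom I s + mulHom I t :=
  homSections_ext fun M hM q ↦ by
    rw [homApp_add, homApp_mulHom, homApp_mulHom, homApp_mulHom, map_add, smul_add]

lemma mulHom_smul (r : Γ(X, N)) (s : Γ(F, N)) : mulHom I (r • s) = r • mulHom I s :=
  homSections_ext fun M hM q ↦ by
    rw [homApp_smul, homApp_mulHom, homApp_mulHom, map_smulₛₗ, smul_comm]

lemma res_mulHom {M : X.Opens} (hM : M ≤ N) (s : Γ(F, N)) :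
    res (sheafHom (idealPresheaf I) F) hM (mulHom I s) = mulHom I (res F hM s) :=
  homSections_ext fun M' hM' q ↦ by
    rw [homApp_res_sheafHom, homApp_mulHom, homApp_mulHom, res_res]

end mulHom

variable {E : Closeds X}

lemma vanishingIdeal_pow_eq_top {W : X.affineOpens} (h : ∀ y ∈ W.1, y ∉ E) (a : ℕ) :
    (Scheme.IdealSheafData.vanishingIdeal E ^ a).ideal W = ⊤ := by
  have h1 : (Scheme.IdealSheafData.vanishingIdeal E).ideal W = ⊤ := by
    have h2 : W.2.fromSpec ⁻¹' (E : Set X) = ∅ :=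
      Set.eq_empty_of_forall_notMem fun p hp ↦ h _ (fromSpec_mem W.2 p) hp
    exact (congrArg PrimeSpectrum.vanishingIdeal h2).trans PrimeSpectrum.vanishingIdeal_empty
  rw [Scheme.IdealSheafData.ideal_pow, Pi.pow_apply, h1, Ideal.top_pow]

lemma one_mem_idealSections {N : X.Opens} (h : ∀ y ∈ N, y ∉ E) (a : ℕ) :
    (1 : Γ(X, N)) ∈ idealSections (Scheme.IdealSheafData.vanishingIdeal E ^ a) N := by
  rw [mem_idealSections]
  intro W hW
  rw [vanishingIdeal_pow_eq_top (fun y hy ↦ h y (hW hy))]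
  trivial

/-- Away from `E`, the sheaf `F` and its twist have the same sections. -/
lemma bijective_mulHom {F : X.Modules} {N : X.Opens} (h : ∀ y ∈ N, y ∉ E) (a : ℕ) :
    Function.Bijective (mulHom (Scheme.IdealSheafData.vanishingIdeal E ^ a) (F := F) (N := N)) := by
  obtain ⟨q, hq⟩ := exists_idealVal_eq (one_mem_idealSections h a)
  refine ⟨fun s t hst ↦ ?_, fun φ ↦ ⟨homApp φ le_rfl q, homSections_ext fun M hM p ↦ ?_⟩⟩
  · have h1 : homApp (mulHom _ s) le_rfl q = homApp (mulHom _ t) le_rfl q := by rw [hst]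
    rwa [homApp_mulHom, homApp_mulHom, hq, one_smul, one_smul, res_self, res_self] at h1
  · have hp : p = idealVal _ M p • resP _ hM q := by
      apply idealVal_injective
      rw [map_smul, idealVal_resP, hq, map_one, smul_eq_mul, mul_one]
    conv_rhs => rw [hp]
    rw [homApp_mulHom, map_smul, resP_homApp φ le_rfl hM]

lemma mem_basicOpen_iff_notMem {Z : X.affineOpens} {t : Γ(X, Z.1)}
    (ht : (Scheme.IdealSheafData.vanishingIdeal E).ideal Z = Ideal.span {t}) {y : X}
    (hy : y ∈ Z.1) : y ∈ X.basicOpen t ↔ y ∉ E := by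
  have h := Scheme.IdealSheafData.mem_supportSet_iff_of_mem
    (I := Scheme.IdealSheafData.vanishingIdeal E) hy
  rw [ht, Scheme.zeroLocus_span, Scheme.mem_zeroLocus_iff] at h
  simp only [Set.mem_singleton_iff, forall_eq] at h
  exact (not_iff_comm.1 h.symm).symm

lemma vanishingIdeal_ideal_of_le {Z W : X.affineOpens} (h : W.1 ≤ Z.1) {t : Γ(X, Z.1)}
    (ht : (Scheme.IdealSheafData.vanishingIdeal E).ideal Z = Ideal.span {t}) :
    (Scheme.IdealSheafData.vanishingIdeal E).ideal W = Ideal.span {resO h t} := by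
  rw [← Scheme.IdealSheafData.map_ideal (U := W) (V := Z) _ h, ht, Ideal.map_span,
    Set.image_singleton]
  rfl

/-- A section of `dual Q` over `N ∩ V` has poles of bounded order along `E` near every point
of `N`, if `E` contains all points of codimension at most one outside `V`. -/
lemma exists_extends_mulHom [IsLocallyNoetherian X] [IsNormal X] {Q : PreMod X}
    (hQ : IsFiniteType Q) (hE : IsCartier E) {V : X.Opens}
    (hV : InjOn (structureSheaf X) V ⊤) (hEV : ∀ y ∈ V, y ∉ E)
    (hcodim : ∀ y : X, ringKrullDim (X.presheaf.stalk y) ≤ 1 → y ∉ E → y ∈ V)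
    {N : X.Opens} (s : Γ(dual Q, N ⊓ V)) {y : X} (hy : y ∈ N) :
    ∃ (Z : X.Opens) (hZ : Z ≤ N), y ∈ Z ∧ ∃ a₀ : ℕ, ∀ a ≥ a₀,
      Extends (twist (dual Q) E a) (V := V) (N := Z) (mulHom _ (res (dual Q)
        (inf_le_inf_right V hZ) s)) := by
  obtain ⟨W₀, t₀, hyW₀, -, ht₀⟩ := hE y
  obtain ⟨Z, hZ, hd, hyZ, hZ', S, hfin, hS⟩ :=
    hQ.exists_isAffineOpen (N := W₀.1 ⊓ N) ⟨hyW₀, hy⟩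
  have hZN : Z ≤ N := hZ'.trans inf_le_right
  have hZW : Z ≤ W₀.1 := hZ'.trans inf_le_left
  obtain ⟨t, ht⟩ : ∃ t : Γ(X, Z),
      (Scheme.IdealSheafData.vanishingIdeal E).ideal ⟨Z, hZ⟩ = Ideal.span {t} :=
    ⟨_, vanishingIdeal_ideal_of_le (W := ⟨Z, hZ⟩) hZW ht₀⟩
  have hVt : Z ⊓ V ≤ X.basicOpen t := fun z hz ↦
    (mem_basicOpen_iff_notMem (Z := ⟨Z, hZ⟩) ht hz.1).2 (hEV z hz.2)
  have ht0 : t ≠ 0 := by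
    intro h0
    have h1 : Z ⊓ V = ⊥ := by
      rw [eq_bot_iff]; refine hVt.trans ?_
      rw [h0, Scheme.basicOpen_zero]
    have h2 : (1 : Γ(X, Z)) = 0 := by
      refine hV.eq (N := Z) le_top (section_ext _ fun z hz ↦ ?_)
      rw [h1] at hz
      exact hz.elim
    exact one_ne_zero h2
  have hG : InjOn (dual Q) V ⊤ := hV.sheafHom Q
  have hD : BijOn (dual Q) V (X.basicOpen t) := (bijOn_structureSheaf fun z hz hdim ↦
    hcodim z hdim ((mem_basicOpen_iff_notMem (Z := ⟨Z, hZ⟩) ht (X.basicOpen_le t hz)).1 hz)).sheafHom Q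
  obtain ⟨φ, hφ⟩ := hD.2 _ le_rfl (res (dual Q)
    (inf_le_inf_right V ((X.basicOpen_le t).trans hZN)) s)
  obtain ⟨a₀, ha₀⟩ := exists_extends_pow_smul hZ hfin hS ht0 φ
  refine ⟨Z, hZN, hyZ, a₀, fun a ha ↦ ?_⟩
  obtain ⟨ψ, hψ⟩ := ha₀ a ha
  -- `ψ` extends `t ^ a • s`
  have hψs : res (dual Q) (inf_le_left : Z ⊓ V ≤ Z) ψ =
      resO (inf_le_left : Z ⊓ V ≤ Z) t ^ a • res (dual Q) (inf_le_inf_right V hZN) s := by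
    have h1 := congrArg (res (dual Q) hVt) hψ
    have h2 := congrArg (res (dual Q) (le_inf hVt inf_le_right)) hφ
    rw [res_res, map_smulₛₗ, map_pow, resO_resO] at h1
    rw [res_res, res_res] at h2
    rw [h1, h2]
  refine exists_hom_extension (hG.mono le_top) _ fun M hM q ↦ ?_
  refine extends_of_local (hG.mono le_top) _ fun z hz ↦ ?_
  obtain ⟨W, hW, hzW, hWM'⟩ := exists_isAffineOpen_mem_and_subset hz
  have hWM : W ≤ M := hWM'
  refine ⟨W, hWM, hzW, ?_⟩
  have h1 : resO hWM (idealVal _ M q) ∈ (Scheme.IdealSheafData.vanishingIdeal E ^ a).ideal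
      ⟨W, hW⟩ := mem_idealSections.1 (idealVal_mem q) ⟨W, hW⟩ hWM
  rw [Scheme.IdealSheafData.ideal_pow, Pi.pow_apply,
    vanishingIdeal_ideal_of_le (W := ⟨W, hW⟩) (hWM.trans hM) ht, Ideal.span_singleton_pow,
    Ideal.mem_span_singleton'] at h1
  obtain ⟨c, hc⟩ := h1
  refine ⟨c • res (dual Q) (hWM.trans hM) ψ, ?_⟩
  have h2 := congrArg (res (dual Q) (inf_le_inf_right V (hWM.trans hM))) hψs
  rw [map_smulₛₗ, map_pow, resO_resO, res_res, res_res] at h2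
  have h3 := congrArg (resO (inf_le_left : W ⊓ V ≤ W)) hc
  rw [map_mul, map_pow, resO_resO, resO_resO] at h3
  rw [map_smulₛₗ, res_res, h2, smul_smul, h3, homApp_mulHom, idealVal_resP, map_smulₛₗ, resO_resO,
    res_res, res_res]

end

section

variable {X Y : Scheme.{u}}

/-! ### Isomorphisms that extend -/

/-- On a Noetherian space, bounds that are valid locally give a uniform bound. -/
lemma exists_uniform_bound {T : Type*} [TopologicalSpace T] [NoetherianSpace T] (N : Set T)
    (p : ℕ → T → Prop) (h : ∀ y ∈ N, ∃ U : Set T, IsOpen U ∧ y ∈ U ∧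
      ∃ a₀ : ℕ, ∀ a ≥ a₀, ∀ z ∈ U, p a z) : ∃ a₀ : ℕ, ∀ a ≥ a₀, ∀ y ∈ N, p a y := by
  refine (NoetherianSpace.isCompact N).induction_on
    (p := fun K ↦ ∃ a₀ : ℕ, ∀ a ≥ a₀, ∀ y ∈ K, p a y) ⟨0, by simp⟩ ?_ ?_ ?_
  · rintro s t hst ⟨a₀, ha⟩
    exact ⟨a₀, fun a h y hy ↦ ha a h y (hst hy)⟩
  · rintro s t ⟨a₁, h₁⟩ ⟨a₂, h₂⟩
    refine ⟨max a₁ a₂, fun a ha y hy ↦ hy.elim (h₁ a (le_of_max_le_left ha) y)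
      (h₂ a (le_of_max_le_right ha) y)⟩
  · intro y hy
    obtain ⟨U, hU, hyU, a₀, ha⟩ := h y hy
    exact ⟨U, mem_nhdsWithin_of_mem_nhds (hU.mem_nhds hyU), a₀, ha⟩

/-- A section of `dual Q` over `N ∩ V` has poles of bounded order along `E`. -/
lemma exists_forall_extends_mulHom [IsNoetherian X] [IsNormal X] {Q : PreMod X}
    (hQ : IsFiniteType Q) {E : Closeds X} (hE : IsCartier E) {V : X.Opens}
    (hV : InjOn (structureSheaf X) V ⊤) (hEV : ∀ y ∈ V, y ∉ E)
    (hcodim : ∀ y : X, ringKrullDim (X.presheaf.stalk y) ≤ 1 → y ∉ E → y ∈ V)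
    {N : X.Opens} (s : Γ(dual Q, N ⊓ V)) :
    ∃ a₀ : ℕ, ∀ a ≥ a₀, Extends (twist (dual Q) E a) (V := V) (N := N) (mulHom _ s) := by
  obtain ⟨a₀, ha₀⟩ := exists_uniform_bound (N : Set X)
    (fun a y ↦ ∃ (Z : X.Opens) (hZ : Z ≤ N), y ∈ Z ∧
      Extends (twist (dual Q) E a) (V := V) (N := Z) (mulHom _ (res (dual Q)
        (inf_le_inf_right V hZ) s))) fun y hy ↦ by
    obtain ⟨Z, hZ, hyZ, a₀, ha₀⟩ := exists_extends_mulHom hQ hE hV hEV hcodim s hy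
    exact ⟨Z, Z.2, hyZ, a₀, fun a ha z hz ↦ ⟨Z, hZ, hz, ha₀ a ha⟩⟩
  refine ⟨a₀, fun a ha ↦ extends_of_local (((hV.sheafHom Q).sheafHom _).mono le_top) _
    fun y hy ↦ ?_⟩
  obtain ⟨Z, hZ, hyZ, h⟩ := ha₀ a ha y hy
  refine ⟨Z, hZ, hyZ, ?_⟩
  have h1 := res_mulHom (I := Scheme.IdealSheafData.vanishingIdeal E ^ a)
    (inf_le_inf_right V hZ) s
  rw [← h1] at h
  exact h

/-- The component over `V ≤ U` of a homomorphism `F|_U ⟶ F'|_U` of sheaves of modules. -/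
def homSec {F F' : X.Modules} {U V : X.Opens} (φ : homSections F.val F' U) (hV : V ≤ U) :
    Γ(F, V) →ₗ[Γ(X, V)] Γ(F', V) := homApp φ hV

lemma res_homSec {F F' : X.Modules} {U V W : X.Opens} (φ : homSections F.val F' U) (hV : V ≤ U)
    (hW : W ≤ V) (s : Γ(F, V)) :
    res F' hW (homSec φ hV s) = homSec φ (hW.trans hV) (res F hW s) :=
  (resP_homApp φ hV hW s).symm

/-- A homomorphism of sheaves of modules which is bijective on sections is an isomorphism. -/
lemma nonempty_iso_of_bijective {F F' : X.Modules} (φ : homSections F.val F' ⊤)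
    (h : ∀ N : X.Opens, Function.Bijective (homSec φ (le_top : N ≤ ⊤))) : Nonempty (F ≅ F') := by
  let g : F.presheaf ⟶ F'.presheaf :=
    { app := fun N ↦ AddCommGrpCat.ofHom (homApp φ (le_top : N.unop ≤ ⊤)).toAddMonoidHom
      naturality := fun N M i ↦ by
        ext s
        exact resP_homApp φ (le_top : N.unop ≤ ⊤) i.unop.le s }
  let ψ : F ⟶ F' := ⟨PresheafOfModules.homMk g fun N r s ↦
    (homApp φ (le_top : N.unop ≤ ⊤)).map_smul r s⟩
  have : IsIso ψ := Scheme.Modules.Hom.isIso_iff_isIso_app.2 fun N ↦ by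
    rw [ConcreteCategory.isIso_iff_bijective]
    exact h N
  exact ⟨asIso ψ⟩

section Extension

variable {H F : X.Modules} {U : X.Opens}

lemma extends_of_mem_span (φ : homSections H.val F U) {Z M : X.Opens} (hM : M ≤ Z)
    {S : Set Γ(H, Z)}
    (hS : ∀ σ ∈ S, Extends F (V := U) (homSec φ inf_le_right (res H inf_le_left σ)))
    {q : Γ(H, M)} (hq : q ∈ Submodule.span Γ(X, M) (res H hM '' S)) :
    Extends F (V := U) (homSec φ inf_le_right (res H inf_le_left q)) := by
  induction hq using Submodule.span_induction with
  | zero => rw [map_zero, map_zero]; exact .zero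
  | add p q _ _ hp hq => rw [map_add, map_add]; exact hp.add hq
  | smul r q _ hq => rw [map_smulₛₗ, map_smul]; exact hq.smul r
  | mem q hq =>
    obtain ⟨σ, hσ, rfl⟩ := hq
    have h := (hS σ hσ).res hM
    rw [res_homSec, res_res] at h
    rw [res_res]
    exact h

/-- The values of a homomorphism extend if its values on generators do. -/
lemma extends_of_generatesLocally (hF : InjOn F U ⊤) (φ : homSections H.val F U) {Z : X.Opens}
    {S : Set Γ(H, Z)} (hS : GeneratesLocally H.val S)
    (hφ : ∀ σ ∈ S, Extends F (V := U) (homSec φ inf_le_right (res H inf_le_left σ)))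
    {N : X.Opens} (hN : N ≤ Z) (q : Γ(H, N)) :
    Extends F (V := U) (homSec φ inf_le_right (res H inf_le_left q)) := by
  refine extends_of_local (hF.mono le_top) _ fun y hy ↦ ?_
  obtain ⟨M, hM, hyM, hspan⟩ := hS N hN q y hy
  have h := extends_of_mem_span φ (hM.trans hN) hφ (q := res H hM q) hspan
  rw [res_res] at h
  refine ⟨M, hM, hyM, ?_⟩
  rw [res_homSec, res_res]
  exact h

lemma extends_of_forall_exists_mem (hF : InjOn F U ⊤) (φ : homSections H.val F U)
    (h : ∀ x : X, ∃ Z : X.Opens, x ∈ Z ∧ ∀ N ≤ Z, ∀ q : Γ(H, N),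
      Extends F (V := U) (homSec φ inf_le_right (res H inf_le_left q)))
    {N : X.Opens} (q : Γ(H, N)) :
    Extends F (V := U) (homSec φ inf_le_right (res H inf_le_left q)) := by
  refine extends_of_local (hF.mono le_top) _ fun y hy ↦ ?_
  obtain ⟨Z, hyZ, hZ⟩ := h y
  have h1 := hZ (N ⊓ Z) inf_le_right (res H inf_le_left q)
  rw [res_res] at h1
  refine ⟨N ⊓ Z, inf_le_left, ⟨hy, hyZ⟩, ?_⟩
  rw [res_homSec, res_res]
  exact h1

/-- An isomorphism over `U` extends to `X` if sections of the source extend uniquely from `N ∩ U` to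
`N`, sections of the target over `N` are determined by their restrictions to `N ∩ U`, and all values
of the isomorphism extend. -/
lemma nonempty_iso_of_extends (hH : BijOn H U ⊤) (hF : InjOn F U ⊤) (φ : homSections H.val F U)
    (hφ : ∀ (N : X.Opens) (hN : N ≤ U), Function.Bijective (homSec φ hN))
    (h : ∀ (N : X.Opens) (q : Γ(H, N)),
      Extends F (V := U) (homSec φ inf_le_right (res H inf_le_left q))) :
    Nonempty (H ≅ F) := by
  let φ' : homSections H.val F (⊤ ⊓ U) := res (sheafHom H.val F) inf_le_right φ
  obtain ⟨ψ, hψ⟩ := exists_hom_extension hF φ' fun N _ q ↦ h N q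
  change homSections H.val F ⊤ at ψ
  have key (N : X.Opens) (q : Γ(H, N)) :
      res F (inf_le_left : N ⊓ U ≤ N) (homSec ψ le_top q) =
        homSec φ inf_le_right (res H inf_le_left q) := by
    rw [res_homSec]
    exact congrArg (fun φ : homSections H.val F (⊤ ⊓ U) ↦
      homSec φ (inf_le_inf_right U le_top) (res H (inf_le_left : N ⊓ U ≤ N) q)) hψ
  refine nonempty_iso_of_bijective ψ fun N ↦ ⟨fun q q' hq ↦ ?_, fun τ ↦ ?_⟩
  · have h1 := congrArg (res F (inf_le_left : N ⊓ U ≤ N)) hq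
    rw [key, key] at h1
    exact hH.1.eq le_top ((hφ _ inf_le_right).1 h1)
  · obtain ⟨q', hq'⟩ := (hφ _ inf_le_right).2 (res F (inf_le_left : N ⊓ U ≤ N) τ)
    obtain ⟨q, rfl⟩ := hH.2 N le_top q'
    exact ⟨q, hF.eq le_top ((key N q).trans hq')⟩

end Extension

section Main

variable {f : Y ⟶ X} {E : Closeds Y} {U : X.Opens}

lemma InjOn.pushforward {G : Y.Modules} (h : InjOn G (f ⁻¹ᵁ U) ⊤) :
    InjOn ((Scheme.Modules.pushforward f).obj G) U ⊤ :=
  fun N _ s hs ↦ h (f ⁻¹ᵁ N) le_top s hs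

/-- The homomorphism from `H` to the direct image of `G(aE)`, over the open subset `U` where `H` is
identified with the direct image of `G`. -/
def twistHom {H : X.Modules} {G : Y.Modules} (c : Comparison f U H.val G.val) (E : Closeds Y)
    (a : ℕ) {N : X.Opens} (hN : N ≤ U) :
    homSections H.val ((Scheme.Modules.pushforward f).obj (twist G E a)) N :=
  mkHom (F := (Scheme.Modules.pushforward f).obj (twist G E a))
    (fun M hM h ↦ mulHom _ (c.sec M (hM.trans hN) h))
    (fun M hM p q ↦ by
      let p' : Γ(H, M) := p
      let q' : Γ(H, M) := q
      change mulHom _ (c.sec M _ (p' + q')) = _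
      rw [map_add, mulHom_add]; rfl)
    (fun M hM r q ↦ by
      let q' : Γ(H, M) := q
      change mulHom _ (c.sec M _ (r • q')) = _
      rw [map_smulₛₗ, mulHom_smul]; rfl)
    (fun M hM M' hM' q ↦ by
      let q' : Γ(H, M) := q
      change mulHom _ (c.sec M' _ (res H hM' q')) = _
      rw [c.res_sec M (hM.trans hN), ← res_mulHom]; rfl)

lemma bijective_twistHom {H : X.Modules} {G : Y.Modules} (c : Comparison f U H.val G.val)
    (hEV : ∀ y ∈ f ⁻¹ᵁ U, y ∉ E) (a : ℕ) {N M : X.Opens} (hN : N ≤ U) (hM : M ≤ N) :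
    Function.Bijective (homSec (twistHom c E a hN) hM) :=
  (bijective_mulHom (F := G) (fun y hy ↦ hEV y (f.preimage_mono (hM.trans hN) hy)) a).comp
    (c.bijective_sec M (hM.trans hN))

/-- The direct image of a sufficiently large twist of a reflexive sheaf on `Y` is the corresponding
reflexive sheaf on `X`. -/
lemma exists_forall_nonempty_iso [IsNoetherian X] [IsNoetherian Y] [IsNormal Y]
    {H : X.Modules} (hH : IsFiniteType H.val) (hHU : BijOn H U ⊤) {Q : PreMod Y}
    (hQ : IsFiniteType Q) (c : Comparison f U H.val (dual Q).val) (hE : IsCartier E)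
    (hV : InjOn (structureSheaf Y) (f ⁻¹ᵁ U) ⊤) (hEV : ∀ y ∈ f ⁻¹ᵁ U, y ∉ E)
    (hcodim : ∀ y : Y, ringKrullDim (Y.presheaf.stalk y) ≤ 1 → y ∉ E → y ∈ f ⁻¹ᵁ U) :
    ∃ a₀ : ℕ, ∀ a : ℕ, a₀ ≤ a →
      Nonempty ((Scheme.Modules.pushforward f).obj (twist (dual Q) E a) ≅ H) := by
  have hinj (a : ℕ) : InjOn ((Scheme.Modules.pushforward f).obj (twist (dual Q) E a)) U ⊤ :=
    ((hV.sheafHom Q).sheafHom _).pushforward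
  obtain ⟨a₀, ha₀⟩ := exists_uniform_bound (Set.univ : Set X) (fun a x ↦ ∃ Z : X.Opens, x ∈ Z ∧
    ∀ N ≤ Z, ∀ h : Γ(H, N),
      Extends ((Scheme.Modules.pushforward f).obj (twist (dual Q) E a)) (V := U) (N := N)
        (homSec (twistHom c E a le_rfl) inf_le_right (res H inf_le_left h))) fun x _ ↦ by
    obtain ⟨Z, hxZ, S, hfin, hS⟩ := hH x
    change Set Γ(H, Z) at S
    have h1 : ∀ᶠ a : ℕ in Filter.atTop, ∀ σ ∈ S,
        Extends ((Scheme.Modules.pushforward f).obj (twist (dual Q) E a)) (V := U) (N := Z)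
          (homSec (twistHom c E a le_rfl) inf_le_right (res H inf_le_left σ)) := by
      refine (Filter.eventually_all_finite hfin).2 fun σ _ ↦ Filter.eventually_atTop.2 ?_
      exact exists_forall_extends_mulHom hQ hE hV hEV hcodim (N := f ⁻¹ᵁ Z)
        (c.sec (Z ⊓ U) inf_le_right (res H inf_le_left σ))
    obtain ⟨a₀, ha₀⟩ := Filter.eventually_atTop.1 h1
    exact ⟨Z, Z.2, hxZ, a₀, fun a ha z hz ↦ ⟨Z, hz, fun N hN h ↦
      extends_of_generatesLocally (hinj a) _ hS (ha₀ a ha) hN h⟩⟩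
  refine ⟨a₀, fun a ha ↦ (nonempty_iso_of_extends hHU (hinj a) (twistHom c E a le_rfl)
    (fun N hN ↦ bijective_twistHom c hEV a le_rfl hN)
    fun N h ↦ extends_of_forall_exists_mem (hinj a) _ (fun x ↦ ha₀ a ha x trivial) h).map
    Iso.symm⟩

end Main

end

section

variable {X Y : Scheme.{u}}

/-! ### Direct images of twisted reflexive sheaves -/

variable {f : Y ⟶ X}

lemma notMem_exceptionalDivisor {y : Y} (hy : y ∈ f ⁻¹ᵁ isoLocus f) :
    y ∉ exceptionalDivisor f := by
  have h : closure {y | ringKrullDim (Y.presheaf.stalk y) = 1 ∧ f y ∉ isoLocus f} ⊆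
      ((f ⁻¹ᵁ isoLocus f : Y.Opens) : Set Y)ᶜ :=
    closure_minimal (fun y hy ↦ hy.2) (f ⁻¹ᵁ isoLocus f).2.isClosed_compl
  exact fun h' ↦ h h' hy

lemma IsBirational.dense_preimage_isoLocus (hf : IsBirational f) :
    Dense ((f ⁻¹ᵁ isoLocus f : Y.Opens) : Set Y) := by
  obtain ⟨U, -, hU, hU'⟩ := hf
  exact hU.mono (f.preimage_mono (le_isoLocus hU'))

/-- Points of codimension zero lie in every dense open subset. -/
lemma mem_of_ringKrullDim_lt_one [IsLocallyNoetherian X] [IsNormal X] {U : X.Opens}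
    (hU : Dense (U : Set X)) {x : X} (hx : ringKrullDim (X.presheaf.stalk x) < 1) : x ∈ U := by
  have h0 : Ring.KrullDimLE 0 (X.presheaf.stalk x) :=
    Ring.krullDimLE_iff.2 (ENat.WithBot.lt_add_one_iff.mp (by simpa using hx))
  have h1 : IsField (X.presheaf.stalk x) := Ring.KrullDimLE.isField_of_isDomain
  have h2 : (⊥ : PrimeSpectrum (X.presheaf.stalk x)) = IsLocalRing.closedPoint _ :=
    PrimeSpectrum.ext (IsLocalRing.isField_iff_maximalIdeal_eq.1 h1).symm
  have h3 := fromSpecStalk_bot_mem hU x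
  rwa [h2, Scheme.fromSpecStalk_closedPoint] at h3

lemma mem_preimage_isoLocus [IsLocallyNoetherian Y] [IsNormal Y] (hf : IsBirational f) {y : Y}
    (hy : ringKrullDim (Y.presheaf.stalk y) ≤ 1) (hyE : y ∉ exceptionalDivisor f) :
    y ∈ f ⁻¹ᵁ isoLocus f := by
  obtain hy | hy := hy.lt_or_eq
  · exact mem_of_ringKrullDim_lt_one hf.dense_preimage_isoLocus hy
  · by_contra h
    exact hyE (subset_closure ⟨hy, h⟩)

/-- If `P` and `Q` agree over the isomorphism locus of `f`, the direct image of a sufficiently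
large twist of the reflexive hull of `Q` is the reflexive hull of `P`. -/
theorem exists_forall_nonempty_reflexiveHull_iso [IsNoetherian X] [IsNoetherian Y] [IsNormal X]
    [IsNormal Y] [IsProper f] (hf : IsBirational f) (hE : IsCartier (exceptionalDivisor f))
    {P : PreMod X} {Q : PreMod Y} (hP : IsFiniteType P) (hQ : IsFiniteType Q)
    (c : Comparison f (isoLocus f) P Q) :
    ∃ a₀ : ℕ, ∀ a : ℕ, a₀ ≤ a → Nonempty ((Scheme.Modules.pushforward f).obj
      (twist (reflexiveHull Q) (exceptionalDivisor f) a) ≅ reflexiveHull P) := by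
  refine exists_forall_nonempty_iso (U := isoLocus f) hP.reflexiveHull ?_ hQ.dual
    c.reflexiveHull hE ?_ (fun y ↦ notMem_exceptionalDivisor)
    fun y hy hyE ↦ mem_preimage_isoLocus hf hy hyE
  · exact (bijOn_structureSheaf fun x _ hx ↦
      mem_isoLocus_of_ringKrullDim_le_one hf hx).sheafHom _
  · refine injOn_structureSheaf fun N _ hN ↦ ?_
    by_contra hne
    obtain ⟨y, hy⟩ := (Opens.ne_bot_iff_nonempty N).1 hne
    obtain ⟨z, hz⟩ := hf.dense_preimage_isoLocus.inter_open_nonempty N N.2 ⟨y, hy⟩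
    have hz' : z ∈ N ⊓ f ⁻¹ᵁ isoLocus f := hz
    rw [hN] at hz'
    exact hz'

end

end

end DirectImages

theorem theorem3p1 {X Y : Scheme.{u}} [IsNoetherian X] [IsNoetherian Y]
    [DirectImages.IsNormal X] [DirectImages.IsNormal Y] (f : Y ⟶ X) [IsProper f]
    (hf : DirectImages.IsBirational f)
    (hE : DirectImages.IsCartier (DirectImages.exceptionalDivisor f)) (m : ℕ) (hm : 1 ≤ m) :
    -- dualizing sheaves on arbitrary Noetherian normal schemes
    (∀ (ωX : X.Modules) (ωY : Y.Modules),
      DirectImages.IsDualizingSheaf ωX → DirectImages.IsDualizingSheaf ωY →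
      Nonempty (((Scheme.Modules.pushforward f).obj ωY).restrict (DirectImages.isoLocus f).ι ≅
        ωX.restrict (DirectImages.isoLocus f).ι) →
      ∃ a₀ : ℕ, ∀ a : ℕ, a₀ ≤ a →
        Nonempty ((Scheme.Modules.pushforward f).obj
          (DirectImages.twist (DirectImages.reflexivePower ωY m)
            (DirectImages.exceptionalDivisor f) a) ≅ DirectImages.reflexivePower ωX m)) ∧
    -- the canonical sheaves of schemes of finite type over a perfect field
    (∀ (k : Type u) [Field k] [PerfectField k] (π : X ⟶ Spec (.of k)) [LocallyOfFiniteType π]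
      (n : ℕ) (_ : ∀ Z ∈ irreducibleComponents X, topologicalKrullDim Z = n),
      ∃ a₀ : ℕ, ∀ a : ℕ, a₀ ≤ a →
        Nonempty ((Scheme.Modules.pushforward f).obj
          (DirectImages.twist
            (DirectImages.reflexivePower (DirectImages.canonicalSheaf (f ≫ π) n) m)
            (DirectImages.exceptionalDivisor f) a) ≅
          DirectImages.reflexivePower (DirectImages.canonicalSheaf π n) m)) := by
  refine ⟨fun ωX ωY hX hY ⟨e⟩ ↦ ?_, fun k _ _ π _ n _ ↦ ?_⟩
  · exact DirectImages.exists_forall_nonempty_reflexiveHull_iso hf hE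
      (hX.isFiniteType.tensorPower m) (hY.isFiniteType.tensorPower m)
      ((DirectImages.Comparison.ofIso e.symm).tensorPower m)
  · have hfin {Z : Scheme.{u}} [IsNoetherian Z] [DirectImages.IsNormal Z] (p : Z ⟶ Spec (.of k))
        [LocallyOfFiniteType p] :
        DirectImages.IsFiniteType (DirectImages.canonicalSheaf p n).val :=
      ((DirectImages.isFiniteType_differentials p).exteriorPower n).reflexiveHull
    exact DirectImages.exists_forall_nonempty_reflexiveHull_iso hf hE
      ((hfin π).tensorPower m) ((hfin (f ≫ π)).tensorPower m)
      ((DirectImages.Comparison.canonicalSheaf π f (DirectImages.isoLocus f) n).tensorPower m)
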